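/- Let $X=\mathbb P^1(\mathbb C)$, let $\mathcal O$ and $\mathcal M$ be its sheaves of holomorphic and meromorphic functions, let $n\ge 1$ and $\mathcal V=\mathcal M^n$. By a vector bundle in $\mathcal V$ we mean an $\mathcal O$-submodule $\mathcal E\subset\mathcal V$ that locally admits an $\mathcal O$-basis of $n$ sections which is also an $\mathcal M$-basis of $\mathcal V$; it is trivial if $\mathcal E\simeq\mathcal O^n$. Fix $x\in X$ and a local coordinate $t$ at $x$, and let $K$ be the field of germs of meromorphic functions at $x$. The stalk $\mathcal E_x$ is a lattice in $\mathcal V_x=K^n$, i.e. the $\mathcal O_x$-span of a $K$-basis of $K^n$. For lattices $\Lambda, M\subset K^n$, the elementary divisors of $M$ in $\Lambda$ are the unique integers $k_\Lambda(M)=(k_1\le\dots\le k_n)$ for which there is an $\mathcal O_x$-basis $(e_i)$ of $\Lambda$ such that $(t^{k_i}e_i)$ is an $\mathcal O_x$-basis of $M$. The building distance $d(\Lambda,M)$ is the length of a shortest path between the homothety classes $[\Lambda]$ and $[M]$ in the graph whose vertices are the homothety classes of lattices, two distinct classes being joined when they have representatives $\Lambda',M'$ with $t\Lambda'\subset M'\subset\Lambda'$.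 For an integer sequence $k$ put $i(k)=\sum_{j=1}^n(\max_i k_i-k_j)$. Let $\mathcal E$ be a vector bundle in $\mathcal V$, and $\Lambda=\mathcal E_x$. A trivialising lattice is the stalk $\tilde M=\mathcal F_x$ of a trivial vector bundle $\mathcal F$ in $\mathcal V$ that coincides with $\mathcal E$ outside $x$; write $\mathbf\Lambda^0$ for the set of these. It is a Birkhoff–Grothendieck trivialisation of $\Lambda$ if moreover $\mathcal F$ has a basis $(\sigma_i)$ of global sections such that $(t^{-k_i}\sigma_i)$ is a basis of $\Lambda$ for some integers $k_i$. The triviality index of $\Lambda$ is $i(\Lambda)=\sum_{j=1}^n(a_1-a_j)$, where $a_1\ge\dots\ge a_n$ is the type of $\mathcal E$, i.e. $\mathcal E\simeq\bigoplus_j\mathcal O(a_j)$. Then for every Birkhoff–Grothendieck trivialisation $M$ of $\Lambda$, $$d(\Lambda,M)=\min_{\tilde M\in\mathbf\Lambda^0}d(\Lambda,\tilde M).$$ Moreover, the type of $\mathcal E$ exists, and $$i(\Lambda)=\min_{\tilde M\in\mathbf\Lambda^0}i(k_\Lambda(\tilde M)).$$ -/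

import Mathlib

open scoped Pointwise Topology

noncomputable section

namespace SphereBundle

/-! ### Germs of meromorphic and holomorphic functions -/

/-- Germs at `0`, over punctured neighbourhoods, of functions meromorphic at `0`. -/
def meroSubring : Subring (Filter.Germ (𝓝[≠] (0 : ℂ)) ℂ) where
  carrier := {g | ∃ f : ℂ → ℂ, MeromorphicAt f 0 ∧ (f : Filter.Germ (𝓝[≠] (0 : ℂ)) ℂ) = g}
  mul_mem' := by
    rintro _ _ ⟨f, hf, rfl⟩ ⟨g, hg, rfl⟩
    exact ⟨f * g, hf.mul hg, rfl⟩
  one_mem' := ⟨1, MeromorphicAt.const 1 0, rfl⟩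
  add_mem' := by
    rintro _ _ ⟨f, hf, rfl⟩ ⟨g, hg, rfl⟩
    exact ⟨f + g, hf.add hg, rfl⟩
  zero_mem' := ⟨0, MeromorphicAt.const 0 0, rfl⟩
  neg_mem' := by
    rintro _ ⟨f, hf, rfl⟩
    exact ⟨-f, hf.neg, rfl⟩

/-- The field of germs of meromorphic functions at a point of the Riemann sphere, written in the
standard local coordinate at that point (convergent Laurent series). -/
def MeroGerm : Type := ↥meroSubring

/-- The underlying germ of a function. -/
def MeroGerm.val (a : MeroGerm) : Filter.Germ (𝓝[≠] (0 : ℂ)) ℂ := Subtype.val a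

instance instCommRingMeroGerm : CommRing MeroGerm := inferInstanceAs (CommRing ↥meroSubring)

theorem MeroGerm.exists_inv (a : MeroGerm) (ha : a ≠ 0) : ∃ b : MeroGerm, a * b = 1 := by
  obtain ⟨_, f, hf, rfl⟩ := a
  rcases hf.eventually_eq_zero_or_eventually_ne_zero with h | h
  · exact absurd (Subtype.ext (Filter.Germ.coe_eq.2 h)) ha
  · exact ⟨⟨_, f⁻¹, hf.inv, rfl⟩,
      Subtype.ext (Filter.Germ.coe_eq.2 (h.mono fun z hz => mul_inv_cancel₀ hz))⟩

instance instFieldMeroGerm : Field MeroGerm :=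
  IsField.toField
    { exists_pair_ne := ⟨0, 1, fun h => zero_ne_one (congrArg MeroGerm.val h)⟩
      mul_comm := mul_comm
      mul_inv_cancel := fun {a} ha => MeroGerm.exists_inv a ha }

/-- The local ring of germs of holomorphic functions. -/
def holo : Subring MeroGerm where
  carrier := {g | ∃ f : ℂ → ℂ, AnalyticAt ℂ f 0 ∧
    (f : Filter.Germ (𝓝[≠] (0 : ℂ)) ℂ) = g.val}
  mul_mem' := by
    rintro ⟨_, _⟩ ⟨_, _⟩ ⟨f, hf, rfl⟩ ⟨g, hg, rfl⟩
    exact ⟨f * g, hf.mul hg, rfl⟩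
  one_mem' := ⟨1, analyticAt_const, rfl⟩
  add_mem' := by
    rintro ⟨_, _⟩ ⟨_, _⟩ ⟨f, hf, rfl⟩ ⟨g, hg, rfl⟩
    exact ⟨f + g, hf.add hg, rfl⟩
  zero_mem' := ⟨0, analyticAt_const, rfl⟩
  neg_mem' := by
    rintro ⟨_, _⟩ ⟨f, hf, rfl⟩
    exact ⟨-f, hf.neg, rfl⟩

/-- The uniformising parameter: the germ of the local coordinate. -/
def unif : MeroGerm := ⟨((fun z : ℂ => z) : ℂ → ℂ), fun z => z, MeromorphicAt.id 0, rfl⟩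

/-! ### Lattices, elementary divisors and the affine building -/

/-- `e` is at the same time a basis of the vector space `Kⁿ` over the field `K` of meromorphic
germs and a basis of the `𝒪`-module `Λ`. -/
def IsLatticeBasis {n : ℕ} (Λ : Submodule holo (Fin n → MeroGerm))
    (e : Fin n → (Fin n → MeroGerm)) : Prop :=
  LinearIndependent MeroGerm e ∧ Submodule.span MeroGerm (Set.range e) = ⊤ ∧
    Submodule.span holo (Set.range e) = Λ

/-- The lattices of `Kⁿ`. -/
structure LatticeOf (n : ℕ) where
  carrier : Submodule holo (Fin n → MeroGerm)
  exists_basis : ∃ e, IsLatticeBasis carrier e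

/-- `k` is the increasing sequence of elementary divisors of `M` in `Λ`, as witnessed by a Smith
basis `e` of `Λ` for `M`. -/
def IsElementaryDivisors {n : ℕ} (Λ M : LatticeOf n) (k : Fin n → ℤ) : Prop :=
  Monotone k ∧ ∃ e : Fin n → (Fin n → MeroGerm), IsLatticeBasis Λ.carrier e ∧
    IsLatticeBasis M.carrier (fun i => unif ^ (k i) • e i)

/-- Homothety of lattices. -/
def homothety (n : ℕ) : Setoid (LatticeOf n) where
  r Λ M := ∃ α : MeroGerm, α ≠ 0 ∧ M.carrier = α • Λ.carrier
  iseqv :=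
    { refl := fun Λ => ⟨1, one_ne_zero, (one_smul _ _).symm⟩
      symm := by
        rintro Λ M ⟨α, hα, h⟩
        exact ⟨α⁻¹, inv_ne_zero hα, by rw [h, smul_smul, inv_mul_cancel₀ hα, one_smul]⟩
      trans := by
        rintro Λ M N ⟨α, hα, h⟩ ⟨β, hβ, h'⟩
        exact ⟨β * α, mul_ne_zero hβ hα, by rw [h', h, smul_smul]⟩ }

/-- The vertices of the affine building: homothety classes of lattices. -/
def Vertex (n : ℕ) : Type := Quotient (homothety n)

/-- The homothety class of a lattice. -/
def LatticeOf.cls {n : ℕ} (Λ : LatticeOf n) : Vertex n := Quotient.mk (homothety n) Λ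

/-- The graph of the affine building: two distinct classes are joined when they have
representatives with `tΛ ⊆ M ⊆ Λ` (a symmetric condition, since then `tM ⊆ tΛ ⊆ M`). -/
def buildingGraph (n : ℕ) : SimpleGraph (Vertex n) :=
  SimpleGraph.fromRel fun L L' => ∃ Λ M : LatticeOf n, Λ.cls = L ∧ M.cls = L' ∧
    unif • Λ.carrier ≤ M.carrier ∧ M.carrier ≤ Λ.carrier

/-- The building distance of two lattices: the length of a shortest path between their classes. -/
def buildingDist {n : ℕ} (Λ M : LatticeOf n) : ℕ := (buildingGraph n).dist Λ.cls M.cls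

/-- The index `i(k) = ∑ⱼ (maxᵢ kᵢ - kⱼ)` of an integer sequence. -/
def seqIndex {n : ℕ} [NeZero n] (k : Fin n → ℤ) : ℤ :=
  ∑ j, (Finset.univ.sup' Finset.univ_nonempty k - k j)

/-! ### The Riemann sphere and meromorphic functions -/

/-- The standard local coordinates of the Riemann sphere `ℂ ∪ {∞}`, as parametrisations sending
`0` to the given point: `t ↦ p + t` at `p ∈ ℂ`, and `t ↦ 1 / t` at `∞`. -/
def localParam (x : OnePoint ℂ) (t : ℂ) : OnePoint ℂ :=
  x.elim (if t = 0 then OnePoint.infty else ((t⁻¹ : ℂ) : OnePoint ℂ))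
    (fun p => ((p + t : ℂ) : OnePoint ℂ))

/-- Meromorphic functions on a subset `U` of the sphere. Values at poles are irrelevant: a
meromorphic function is only ever used through its germs. -/
def MeroFun (U : Set (OnePoint ℂ)) : Type :=
  {f : OnePoint ℂ → ℂ // ∀ y ∈ U, MeromorphicAt (fun t => f (localParam y t)) 0}

/-- The germ at `y` of a meromorphic function. -/
def MeroFun.germ {U : Set (OnePoint ℂ)} (f : MeroFun U) (y : OnePoint ℂ) (hy : y ∈ U) :
    MeroGerm :=
  ⟨((fun t => f.1 (localParam y t)) : ℂ → ℂ), _, f.2 y hy, rfl⟩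

/-- The germ at `y` of a tuple of meromorphic functions, i.e. of a section of `ℳⁿ`. -/
def germVec {n : ℕ} {U : Set (OnePoint ℂ)} (s : Fin n → MeroFun U) (y : OnePoint ℂ)
    (hy : y ∈ U) : Fin n → MeroGerm :=
  fun j => (s j).germ y hy

/-! ### Holomorphic vector bundles inside the meromorphic bundle `ℳⁿ` -/

/-- A holomorphic vector bundle of rank `n` in `𝒱 = ℳⁿ`: a subsheaf of `𝒪`-modules of `𝒱`, given
by its stalks, that near every point has a frame consisting of meromorphic sections. Its sections
over an open set are the sections of `𝒱` whose germs lie in the stalks. -/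
structure VBundle (n : ℕ) where
  stalk : OnePoint ℂ → Submodule holo (Fin n → MeroGerm)
  locallyFree : ∀ x : OnePoint ℂ, ∃ U : Set (OnePoint ℂ), IsOpen U ∧ x ∈ U ∧
    ∃ e : Fin n → Fin n → MeroFun U, ∀ (y : OnePoint ℂ) (hy : y ∈ U),
      IsLatticeBasis (stalk y) (fun i => germVec (e i) y hy)

/-- The stalk of a bundle at `x`, as a lattice. -/
def VBundle.lattice {n : ℕ} (E : VBundle n) (x : OnePoint ℂ) : LatticeOf n :=
  ⟨E.stalk x, by
    obtain ⟨U, _, hx, e, he⟩ := E.locallyFree x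
    exact ⟨_, he x hx⟩⟩

/-- `σ` is a global frame of `F`, that is, an isomorphism `𝒪ⁿ ≃ F`. -/
def IsGlobalFrame {n : ℕ} (F : VBundle n) (σ : Fin n → Fin n → MeroFun Set.univ) : Prop :=
  ∀ y : OnePoint ℂ, IsLatticeBasis (F.stalk y) (fun i => germVec (σ i) y (Set.mem_univ y))

/-- Trivial bundles. -/
def IsTrivial {n : ℕ} (F : VBundle n) : Prop := ∃ σ, IsGlobalFrame F σ

/-- `E` and `F` coincide outside `x`. -/
def AgreeOff {n : ℕ} (x : OnePoint ℂ) (E F : VBundle n) : Prop :=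
  ∀ y, y ≠ x → E.stalk y = F.stalk y

/-- The trivialising lattices in the coset of `E` at `x`, each identified with the (trivial) bundle
that has this lattice as stalk at `x` and coincides with `E` elsewhere. -/
def trivialisations {n : ℕ} (E : VBundle n) (x : OnePoint ℂ) : Set (VBundle n) :=
  {F | AgreeOff x E F ∧ IsTrivial F}

/-- `F` is a Birkhoff–Grothendieck trivialisation of `E` at `x`: it coincides with `E` outside `x`,
and it has a basis `σ` of global sections such that, for some integers `k`, the `t^{-kᵢ} σᵢ` form
a basis of the stalk of `E` at `x`. -/
def IsBGTrivialisation {n : ℕ} (E F : VBundle n) (x : OnePoint ℂ) : Prop :=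
  AgreeOff x E F ∧ ∃ σ, IsGlobalFrame F σ ∧ ∃ k : Fin n → ℤ,
    IsLatticeBasis (E.stalk x) (fun i => unif ^ (-k i) • germVec (σ i) x (Set.mem_univ x))

open Classical in
/-- `E` has type `a₁ ≥ ⋯ ≥ aₙ`, that is `E ≃ 𝒪(a₁) ⊕ ⋯ ⊕ 𝒪(aₙ)`, where `𝒪(a)` is the sheaf of
meromorphic functions that are holomorphic on `ℂ` and have order at least `-a` at `∞`. The
meromorphic sections `sᵢ` are the images of the constants `1` of the summands. -/
def HasType {n : ℕ} (E : VBundle n) (a : Fin n → ℤ) : Prop :=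
  Antitone a ∧ ∃ s : Fin n → Fin n → MeroFun Set.univ, ∀ y : OnePoint ℂ,
    IsLatticeBasis (E.stalk y) (fun i =>
      unif ^ (if y = OnePoint.infty then -a i else 0) • germVec (s i) y (Set.mem_univ y))

/-- `m` is the triviality index `∑ᵢ (a₁ - aᵢ)` of `E`, where `a` is the type of `E`. -/
def IsTrivialityIndex {n : ℕ} [NeZero n] (E : VBundle n) (m : ℤ) : Prop :=
  ∃ a : Fin n → ℤ, HasType E a ∧ m = ∑ i, (a 0 - a i)

end SphereBundle

end

/-! The engine is Liouville's theorem. Let `S` be a frame of `E` outside `x` such that the `t^{-kᵢ}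
Sᵢ` form a basis of `Λ`, and let `T` be a global frame of a trivial bundle `F` that agrees with `E`
outside `x`. The entries of `S T⁻¹` and `T S⁻¹` are holomorphic outside `x`, so a nonzero entry
cannot vanish at `x` (`ord_germAt_nonpos`, `ord_transition_nonpos`). Some entry of each row and of
each column is nonzero. Hence `β Λ ⊆ F_x` forces `ord β ≥ kᵢ` for all `i`
(`IsSplittingFrame.le_ord`), and `β F_x ⊆ Λ` forces `ord β ≥ -kⱼ` for all `j`
(`IsSplittingFrame.neg_le_ord`).

Distance: a path of length `r` amounts, up to shortening, to inclusions `t^r Λ ⊆ α F_x ⊆ Λ`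
(`sandwiched_buildingDist`, `buildingDist_le`). The two bounds then add up to `r ≥ kᵢ - kⱼ`, and the
lattice spanned by `S` itself attains `max k - min k`.

Index: the determinant of the transition matrix has order `0` at `x`, by Liouville in both
directions, so the elementary divisors of every trivialising lattice have sum `∑ kᵢ`. Their maximum
`m` satisfies `t^m Λ ⊆ F_x`, so it is at least `max k`. Thus `n * max - sum` is smallest for the
lattice spanned by `S`, where the divisors are the `kᵢ`.

The type exists by a splitting argument (`exists_splitting`). The constant frame generates `E`
outside finitely many points. It is repaired at the finite ones, then made to split at infinity, by
row operations that lower the order of a determinant until it reaches that of a lattice basis. -/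

open scoped Matrix

noncomputable section

namespace SphereBundle

/-! ### The order of a meromorphic germ and the residue map -/

namespace MeroGerm

/-- The germ of a function meromorphic at `0`. -/
def mk (f : ℂ → ℂ) (hf : MeromorphicAt f 0) : MeroGerm := ⟨f, f, hf, rfl⟩

theorem mk_eq_mk {f g : ℂ → ℂ} {hf : MeromorphicAt f 0} {hg : MeromorphicAt g 0} :
    mk f hf = mk g hg ↔ f =ᶠ[𝓝[≠] 0] g :=
  ⟨fun h => Filter.Germ.coe_eq.1 (congrArg MeroGerm.val h),
    fun h => Subtype.ext (Filter.Germ.coe_eq.2 h)⟩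

theorem exists_eq_mk (a : MeroGerm) : ∃ (f : ℂ → ℂ) (hf : MeromorphicAt f 0), mk f hf = a := by
  obtain ⟨_, f, hf, rfl⟩ := a
  exact ⟨f, hf, rfl⟩

theorem mk_mul {f g : ℂ → ℂ} (hf : MeromorphicAt f 0) (hg : MeromorphicAt g 0) :
    mk f hf * mk g hg = mk (f * g) (hf.mul hg) := rfl

theorem mk_eq_zero {f : ℂ → ℂ} {hf : MeromorphicAt f 0} :
    mk f hf = 0 ↔ meromorphicOrderAt f 0 = ⊤ := by
  rw [meromorphicOrderAt_eq_top_iff]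
  exact mk_eq_mk (hg := MeromorphicAt.const 0 0)

/-- The order of a meromorphic germ; the zero germ has order `0` by convention. -/
def ord (a : MeroGerm) : ℤ := (meromorphicOrderAt (exists_eq_mk a).choose 0).untop₀

theorem ord_mk {f : ℂ → ℂ} (hf : MeromorphicAt f 0) :
    ord (mk f hf) = (meromorphicOrderAt f 0).untop₀ := by
  obtain ⟨_, h⟩ := (exists_eq_mk (mk f hf)).choose_spec
  rw [ord, meromorphicOrderAt_congr (mk_eq_mk.1 h)]

theorem ord_mul {a b : MeroGerm} (ha : a ≠ 0) (hb : b ≠ 0) : ord (a * b) = ord a + ord b := by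
  obtain ⟨f, hf, rfl⟩ := exists_eq_mk a
  obtain ⟨g, hg, rfl⟩ := exists_eq_mk b
  rw [mk_mul, ord_mk, ord_mk, ord_mk, meromorphicOrderAt_mul hf hg]
  exact WithTop.untop₀_add (fun h => ha (mk_eq_zero.2 h)) (fun h => hb (mk_eq_zero.2 h))

theorem ord_one : ord 1 = 0 := by
  have := ord_mul one_ne_zero one_ne_zero
  rw [mul_one] at this
  omega

theorem ord_inv {a : MeroGerm} (ha : a ≠ 0) : ord a⁻¹ = -ord a := by
  have := ord_mul ha (inv_ne_zero ha)
  rw [mul_inv_cancel₀ ha, ord_one] at this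
  omega

theorem ord_zpow {a : MeroGerm} (ha : a ≠ 0) (m : ℤ) : ord (a ^ m) = m * ord a := by
  induction m using Int.induction_on with
  | zero => simp [ord_one]
  | succ k ih => rw [zpow_add_one₀ ha, ord_mul (zpow_ne_zero _ ha) ha, ih]; ring
  | pred k ih =>
    rw [zpow_sub_one₀ ha, ord_mul (zpow_ne_zero _ ha) (inv_ne_zero ha), ih, ord_inv ha]; ring

theorem unif_eq_mk : unif = mk (fun z => z) (MeromorphicAt.id 0) := rfl

theorem meromorphicOrderAt_id : meromorphicOrderAt (fun z : ℂ => z) 0 = 1 := by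
  refine (meromorphicOrderAt_eq_int_iff (MeromorphicAt.id 0) (n := 1)).2
    ⟨1, analyticAt_const, one_ne_zero, ?_⟩
  filter_upwards with z
  simp

theorem ord_unif : ord unif = 1 := by
  rw [unif_eq_mk, ord_mk, meromorphicOrderAt_id]
  rfl

theorem unif_ne_zero : unif ≠ 0 := by
  rw [unif_eq_mk, Ne, mk_eq_zero, meromorphicOrderAt_id]
  decide

theorem ord_unif_zpow (m : ℤ) : ord (unif ^ m) = m := by
  rw [ord_zpow unif_ne_zero, ord_unif, mul_one]

theorem mk_mem_holo {f : ℂ → ℂ} (hf : AnalyticAt ℂ f 0) : mk f hf.meromorphicAt ∈ holo :=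
  ⟨f, hf, rfl⟩

theorem exists_eq_mk_of_mem_holo {a : MeroGerm} (ha : a ∈ holo) :
    ∃ (f : ℂ → ℂ) (hf : AnalyticAt ℂ f 0), mk f hf.meromorphicAt = a := by
  obtain ⟨f, hf, h⟩ := ha
  exact ⟨f, hf, Subtype.ext h⟩

theorem mem_holo_iff {a : MeroGerm} : a ∈ holo ↔ a = 0 ∨ 0 ≤ ord a := by
  constructor
  · intro ha
    obtain ⟨f, hf, rfl⟩ := exists_eq_mk_of_mem_holo ha
    refine or_iff_not_imp_left.2 fun h0 => ?_
    rw [ord_mk]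
    have := hf.meromorphicOrderAt_nonneg
    exact WithTop.untop₀_nonneg.2 this
  · rintro (rfl | h)
    · exact holo.zero_mem
    obtain ⟨f, hf, rfl⟩ := exists_eq_mk a
    rw [ord_mk] at h
    by_cases h0 : meromorphicOrderAt f 0 = ⊤
    · rw [mk_eq_zero.2 h0]; exact holo.zero_mem
    obtain ⟨g, hg, -, hfg⟩ := (meromorphicOrderAt_eq_int_iff hf).1 (WithTop.coe_untop₀_of_ne_top h0).symm
    obtain ⟨m, hm⟩ := Int.eq_ofNat_of_zero_le h
    -- The function `f` may have a wrong value at `0`. Germs over punctured neighbourhoods ignore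
    -- it, so the analytic function `z ^ m * g z` represents the same germ.
    have hz : AnalyticAt ℂ (fun z : ℂ => z ^ m * g z) 0 := by fun_prop
    have : mk f hf = mk _ hz.meromorphicAt := by
      refine mk_eq_mk.2 ?_
      filter_upwards [hfg] with z hz
      rw [hz, hm]
      simp
    rw [this]
    exact mk_mem_holo hz

theorem ord_nonneg_of_mem {a : MeroGerm} (ha : a ∈ holo) (h0 : a ≠ 0) : 0 ≤ ord a :=
  (mem_holo_iff.1 ha).resolve_left h0

theorem mem_holo_of_ord {a : MeroGerm} (h : 0 ≤ ord a) : a ∈ holo := mem_holo_iff.2 (Or.inr h)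

theorem unif_mem_holo : unif ∈ holo := mem_holo_of_ord (by simp [ord_unif])

/-- The constant germs. -/
def const : ℂ →+* MeroGerm where
  toFun c := mk (fun _ => c) (MeromorphicAt.const c 0)
  map_one' := rfl
  map_mul' _ _ := rfl
  map_zero' := rfl
  map_add' _ _ := rfl

theorem const_mem_holo (c : ℂ) : const c ∈ holo := mk_mem_holo analyticAt_const

theorem const_ne_zero {c : ℂ} (hc : c ≠ 0) : const c ≠ 0 := (map_ne_zero const).2 hc

theorem ord_const {c : ℂ} (hc : c ≠ 0) : ord (const c) = 0 := by
  have h1 := ord_nonneg_of_mem (const_mem_holo c) (const_ne_zero hc)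
  have h2 := ord_nonneg_of_mem (const_mem_holo c⁻¹) (const_ne_zero (inv_ne_zero hc))
  rw [map_inv₀, ord_inv (const_ne_zero hc)] at h2
  omega

/-- By continuity, a punctured germ determines the value at `0` of an analytic representative. This
makes the chosen representative in `resFun` harmless. -/
theorem eq_of_mk_eq_mk {f g : ℂ → ℂ} (hf : AnalyticAt ℂ f 0) (hg : AnalyticAt ℂ g 0)
    (h : mk f hf.meromorphicAt = mk g hg.meromorphicAt) : f 0 = g 0 :=
  ((hf.continuousAt.eventuallyEq_nhds_iff_eventuallyEq_nhdsNE hg.continuousAt).1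
    (mk_eq_mk.1 h)).self_of_nhds

/-- The value at `0` of a holomorphic germ. -/
def resFun (a : holo) : ℂ := (exists_eq_mk_of_mem_holo a.2).choose 0

theorem resFun_mk {f : ℂ → ℂ} (hf : AnalyticAt ℂ f 0) {h : mk f hf.meromorphicAt ∈ holo} :
    resFun ⟨mk f hf.meromorphicAt, h⟩ = f 0 := by
  obtain ⟨hg, he⟩ := (exists_eq_mk_of_mem_holo h).choose_spec
  exact eq_of_mk_eq_mk hg hf he

/-- The reduction of holomorphic germs modulo the uniformising parameter. -/
def res : holo →+* ℂ where
  toFun := resFun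
  map_one' := resFun_mk (f := fun _ => 1) analyticAt_const
  map_mul' := by
    rintro ⟨a, ha⟩ ⟨b, hb⟩
    obtain ⟨f, hf, rfl⟩ := exists_eq_mk_of_mem_holo ha
    obtain ⟨g, hg, rfl⟩ := exists_eq_mk_of_mem_holo hb
    rw [resFun_mk hf, resFun_mk hg]
    exact resFun_mk (hf.mul hg)
  map_zero' := resFun_mk (f := fun _ => 0) analyticAt_const
  map_add' := by
    rintro ⟨a, ha⟩ ⟨b, hb⟩
    obtain ⟨f, hf, rfl⟩ := exists_eq_mk_of_mem_holo ha
    obtain ⟨g, hg, rfl⟩ := exists_eq_mk_of_mem_holo hb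
    rw [resFun_mk hf, resFun_mk hg]
    exact resFun_mk (hf.add hg)

theorem res_mk {f : ℂ → ℂ} (hf : AnalyticAt ℂ f 0) {h : mk f hf.meromorphicAt ∈ holo} :
    res ⟨mk f hf.meromorphicAt, h⟩ = f 0 := resFun_mk hf

theorem res_const (c : ℂ) : res ⟨const c, const_mem_holo c⟩ = c :=
  res_mk (f := fun _ => c) analyticAt_const

theorem res_unif : res ⟨unif, unif_mem_holo⟩ = 0 := res_mk (f := fun z => z) analyticAt_id

/-- With `mem_of_res_eq_zero`, this identifies the kernel of `res` with the ideal generated by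
`unif`: divisibility by `t` becomes vanishing over `ℂ`. -/
theorem res_eq_zero_of_mem {a : MeroGerm} (ha : a ∈ holo) (h : unif⁻¹ * a ∈ holo) :
    res ⟨a, ha⟩ = 0 := by
  have : (⟨a, ha⟩ : holo) = ⟨unif, unif_mem_holo⟩ * ⟨unif⁻¹ * a, h⟩ :=
    Subtype.ext (mul_inv_cancel_left₀ unif_ne_zero a).symm
  rw [this, map_mul, res_unif, zero_mul]

theorem mem_of_res_eq_zero {a : MeroGerm} (ha : a ∈ holo) (h : res ⟨a, ha⟩ = 0) :
    unif⁻¹ * a ∈ holo := by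
  by_cases h0 : a = 0
  · simp [h0, holo.zero_mem]
  have h1 := ord_nonneg_of_mem ha h0
  rcases h1.eq_or_lt with h2 | h2
  · exfalso
    have hi : a⁻¹ ∈ holo := mem_holo_of_ord (by rw [ord_inv h0]; omega)
    have : (⟨a, ha⟩ : holo) * ⟨a⁻¹, hi⟩ = 1 := Subtype.ext (mul_inv_cancel₀ h0)
    have := congrArg res this
    rw [map_mul, h, zero_mul, map_one] at this
    exact zero_ne_one this
  · exact mem_holo_of_ord (by rw [ord_mul (inv_ne_zero unif_ne_zero) h0, ord_inv unif_ne_zero, ord_unif]; omega)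

end MeroGerm

end SphereBundle

namespace SphereBundle

open MeroGerm Matrix

variable {n : ℕ}

/-! ### Matrices over the holomorphic germs -/

/-- The matrix of holomorphic germs underlying a matrix with holomorphic entries. -/
def holoLift (G : Matrix (Fin n) (Fin n) MeroGerm) (h : ∀ i j, G i j ∈ holo) :
    Matrix (Fin n) (Fin n) holo := fun i j => ⟨G i j, h i j⟩

theorem map_holoLift (G : Matrix (Fin n) (Fin n) MeroGerm) (h : ∀ i j, G i j ∈ holo) :
    holo.subtype.mapMatrix (holoLift G h) = G := rfl

theorem det_mem_holo {G : Matrix (Fin n) (Fin n) MeroGerm} (h : ∀ i j, G i j ∈ holo) :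
    G.det ∈ holo := by
  rw [← map_holoLift G h, ← RingHom.map_det]
  exact ((holoLift G h).det).2

theorem adjugate_mem_holo {G : Matrix (Fin n) (Fin n) MeroGerm} (h : ∀ i j, G i j ∈ holo)
    (i j : Fin n) : G.adjugate i j ∈ holo := by
  rw [← map_holoLift G h, ← RingHom.map_adjugate]
  exact ((holoLift G h).adjugate i j).2

theorem inv_mem_holo {G : Matrix (Fin n) (Fin n) MeroGerm} (h : ∀ i j, G i j ∈ holo)
    (h0 : G.det ≠ 0) (hd : ord G.det = 0) (i j : Fin n) : G⁻¹ i j ∈ holo := by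
  rw [Matrix.inv_def, Ring.inverse_eq_inv', Matrix.smul_apply, smul_eq_mul]
  exact holo.mul_mem (mem_holo_of_ord (by rw [ord_inv h0, hd, neg_zero])) (adjugate_mem_holo h i j)

theorem vecMul_mem_holo {G : Matrix (Fin n) (Fin n) MeroGerm} (h : ∀ i j, G i j ∈ holo)
    {v : Fin n → MeroGerm} (hv : ∀ i, v i ∈ holo) (j : Fin n) : (v ᵥ* G) j ∈ holo :=
  holo.sum_mem fun i _ => holo.mul_mem (hv i) (h i j)

/-- A matrix of holomorphic germs whose determinant vanishes at the point has a nontrivial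
relation between its rows at the point. -/
theorem exists_relation_of_ord_det_pos {G : Matrix (Fin n) (Fin n) MeroGerm}
    (h : ∀ i j, G i j ∈ holo) (h0 : G.det ≠ 0) (hd : 0 < ord G.det) :
    ∃ c : Fin n → ℂ, c ≠ 0 ∧ ∀ j, unif⁻¹ * ∑ i, const (c i) * G i j ∈ holo := by
  have hdet : (res.mapMatrix (holoLift G h)).det = 0 := by
    rw [← RingHom.map_det]
    have h1 : G.det = ((holoLift G h).det : holo) :=
      (RingHom.map_det holo.subtype (holoLift G h)).symm
    refine res_eq_zero_of_mem (a := ((holoLift G h).det : holo)) (Subtype.property _) ?_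
    rw [← h1]
    exact mem_holo_of_ord (by
      rw [ord_mul (inv_ne_zero unif_ne_zero) h0, ord_inv unif_ne_zero, ord_unif]; omega)
  -- The reduced matrix over `ℂ` is singular. A vector in its left kernel lifts to constant germs.
  obtain ⟨c, hc, hcG⟩ := Matrix.exists_vecMul_eq_zero_iff.2 hdet
  refine ⟨c, hc, fun j => ?_⟩
  have hs : (((∑ i, ⟨const (c i), const_mem_holo _⟩ * holoLift G h i j : holo)) : MeroGerm) =
      ∑ i, const (c i) * G i j := by
    rw [AddSubmonoidClass.coe_finsetSum]
    rfl
  rw [← hs]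
  refine mem_of_res_eq_zero (Subtype.property _) ?_
  have := congrFun hcG j
  rw [Subtype.coe_eta, map_sum]
  refine Eq.trans (Finset.sum_congr rfl fun i _ => ?_) this
  rw [map_mul, res_const]
  rfl

/-! ### Bases of lattices -/

/-- The matrix whose rows are those of `S`, multiplied by the `d i`. -/
def scaleRows {R : Type*} [CommRing R] (d : Fin n → R) (S : Matrix (Fin n) (Fin n) R) :
    Matrix (Fin n) (Fin n) R := fun i => d i • S i

theorem det_scaleRows {R : Type*} [CommRing R] (d : Fin n → R) (S : Matrix (Fin n) (Fin n) R) :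
    (scaleRows d S).det = (∏ i, d i) * S.det :=
  Matrix.det_mul_column d S

theorem det_scaleRows_ne_zero {R : Type*} [Field R] {d : Fin n → R} (hd : ∀ i, d i ≠ 0)
    {S : Matrix (Fin n) (Fin n) R} (hS : S.det ≠ 0) : (scaleRows d S).det ≠ 0 := by
  rw [det_scaleRows]
  exact mul_ne_zero (Finset.prod_ne_zero_iff.2 fun i _ => hd i) hS

theorem det_mul_inv (A B : Matrix (Fin n) (Fin n) MeroGerm) :
    (A * B⁻¹).det = A.det * B.det⁻¹ := by
  rw [Matrix.det_mul, Matrix.det_nonsing_inv, Ring.inverse_eq_inv']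

theorem det_mul_inv_ne_zero {A B : Matrix (Fin n) (Fin n) MeroGerm} (hA : A.det ≠ 0)
    (hB : B.det ≠ 0) : (A * B⁻¹).det ≠ 0 := by
  rw [det_mul_inv]
  exact mul_ne_zero hA (inv_ne_zero hB)

theorem LatticeOf.exists_matrix (Λ : LatticeOf n) :
    ∃ B : Matrix (Fin n) (Fin n) MeroGerm, IsLatticeBasis Λ.carrier B := Λ.exists_basis

/-- The coordinates of `v` in the rows of `B` are `v ᵥ* B⁻¹`, so lattice questions become holomorphy
of matrix entries. Spanning over `K` is automatic by dimension. -/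
theorem isLatticeBasis_iff {Λ : Submodule holo (Fin n → MeroGerm)}
    {B : Matrix (Fin n) (Fin n) MeroGerm} :
    IsLatticeBasis Λ B ↔ B.det ≠ 0 ∧ ∀ v, v ∈ Λ ↔ ∀ i, (v ᵥ* B⁻¹) i ∈ holo := by
  have key (h0 : B.det ≠ 0) (v : Fin n → MeroGerm) :
      v ∈ Submodule.span holo (Set.range (B : Fin n → Fin n → MeroGerm)) ↔
        ∀ i, (v ᵥ* B⁻¹) i ∈ holo := by
    have hu : IsUnit B.det := h0.isUnit
    refine (Submodule.mem_span_range_iff_exists_fun holo).trans ?_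
    constructor
    · rintro ⟨c, rfl⟩ i
      have : ∑ i, c i • B i = (fun i => (c i : MeroGerm)) ᵥ* B := by
        rw [Matrix.vecMul_eq_sum]; rfl
      rw [this, Matrix.vecMul_vecMul, Matrix.mul_nonsing_inv _ hu, Matrix.vecMul_one]
      exact (c i).2
    · intro h
      refine ⟨fun i => ⟨_, h i⟩, ?_⟩
      have : ∑ i, (⟨_, h i⟩ : holo) • B i = (v ᵥ* B⁻¹) ᵥ* B :=
        (Matrix.vecMul_eq_sum _ _).symm
      rw [this, Matrix.vecMul_vecMul, Matrix.nonsing_inv_mul _ hu, Matrix.vecMul_one]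
  constructor
  · rintro ⟨hli, -, hΛ⟩
    have h0 : B.det ≠ 0 :=
      ((Matrix.isUnit_iff_isUnit_det B).1 (Matrix.linearIndependent_rows_iff_isUnit.1 hli)).ne_zero
    exact ⟨h0, fun v => by rw [← hΛ, key h0]⟩
  · rintro ⟨h0, hΛ⟩
    have hli : LinearIndependent MeroGerm (B : Fin n → Fin n → MeroGerm) :=
      Matrix.linearIndependent_rows_iff_isUnit.2 ((Matrix.isUnit_iff_isUnit_det B).2 h0.isUnit)
    refine ⟨hli, hli.span_eq_top_of_card_eq_finrank' (by simp), ?_⟩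
    ext v
    rw [key h0, hΛ]

namespace IsLatticeBasis

variable {Λ : Submodule holo (Fin n → MeroGerm)} {B C : Matrix (Fin n) (Fin n) MeroGerm}

theorem det_ne_zero (h : IsLatticeBasis Λ B) : B.det ≠ 0 := (isLatticeBasis_iff.1 h).1

theorem mem_iff (h : IsLatticeBasis Λ B) {v : Fin n → MeroGerm} :
    v ∈ Λ ↔ ∀ i, (v ᵥ* B⁻¹) i ∈ holo := (isLatticeBasis_iff.1 h).2 v

theorem row_mem (h : IsLatticeBasis Λ B) (i : Fin n) : B i ∈ Λ := by
  rw [← h.2.2]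
  exact Submodule.subset_span ⟨i, rfl⟩

theorem entry_mem (h : IsLatticeBasis Λ B) (hC : ∀ i, C i ∈ Λ) (i j : Fin n) :
    (C * B⁻¹) i j ∈ holo := by
  have := h.mem_iff.1 (hC i) j
  rwa [Matrix.mul_apply_eq_vecMul]

/-- The matrix `C * B⁻¹` is holomorphic, so its determinant has nonnegative order. Lattice bases
thus minimise the order of the determinant, which serves as the measure in the inductions below. -/
theorem ord_det_le (h : IsLatticeBasis Λ B) (hC : ∀ i, C i ∈ Λ) (h0 : C.det ≠ 0) :
    ord B.det ≤ ord C.det := by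
  have hB := h.det_ne_zero
  have h1 : (C * B⁻¹).det ≠ 0 := det_mul_inv_ne_zero h0 hB
  have h2 := ord_nonneg_of_mem (det_mem_holo (h.entry_mem hC)) h1
  rw [det_mul_inv, ord_mul h0 (inv_ne_zero hB), ord_inv hB] at h2
  omega

theorem ord_det_eq (h : IsLatticeBasis Λ B) (h' : IsLatticeBasis Λ C) :
    ord B.det = ord C.det :=
  le_antisymm (h.ord_det_le h'.row_mem h'.det_ne_zero) (h'.ord_det_le h.row_mem h.det_ne_zero)

/-- Elements of a lattice form a basis as soon as their determinant has the right order. -/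
theorem of_ord_det (h : IsLatticeBasis Λ B) (hC : ∀ i, C i ∈ Λ) (h0 : C.det ≠ 0)
    (hd : ord C.det = ord B.det) : IsLatticeBasis Λ C := by
  have hB := h.det_ne_zero
  have h1 : (C * B⁻¹).det ≠ 0 := det_mul_inv_ne_zero h0 hB
  have hd' : ord (C * B⁻¹).det = 0 := by
    rw [det_mul_inv, ord_mul h0 (inv_ne_zero hB), ord_inv hB]; omega
  have hCB : C * B⁻¹ * B = C := Matrix.nonsing_inv_mul_cancel_right _ _ hB.isUnit
  refine isLatticeBasis_iff.2 ⟨h0, fun v => h.mem_iff.trans ⟨fun hv => ?_, fun hv => ?_⟩⟩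
  · have : v ᵥ* C⁻¹ = (v ᵥ* B⁻¹) ᵥ* (C * B⁻¹)⁻¹ := by
      rw [Matrix.vecMul_vecMul, Matrix.mul_inv_rev, Matrix.nonsing_inv_nonsing_inv _ hB.isUnit,
        Matrix.nonsing_inv_mul_cancel_left _ _ hB.isUnit]
    rw [this]
    exact vecMul_mem_holo (inv_mem_holo (h.entry_mem hC) h1 hd') hv
  · have : v ᵥ* B⁻¹ = (v ᵥ* C⁻¹) ᵥ* (C * B⁻¹) := by
      rw [Matrix.vecMul_vecMul, Matrix.nonsing_inv_mul_cancel_left _ _ h0.isUnit]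
    rw [this]
    exact vecMul_mem_holo (h.entry_mem hC) hv

/-- Either elements of a lattice form a basis, or a nontrivial constant combination of them is
divisible by the uniformising parameter. -/
theorem exists_relation (h : IsLatticeBasis Λ B) (hC : ∀ i, C i ∈ Λ) (h0 : C.det ≠ 0)
    (hd : ord B.det < ord C.det) :
    ∃ c : Fin n → ℂ, c ≠ 0 ∧ unif⁻¹ • ∑ i, const (c i) • C i ∈ Λ := by
  have hB := h.det_ne_zero
  have h1 : (C * B⁻¹).det ≠ 0 := det_mul_inv_ne_zero h0 hB
  have hd' : 0 < ord (C * B⁻¹).det := by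
    rw [det_mul_inv, ord_mul h0 (inv_ne_zero hB), ord_inv hB]; omega
  obtain ⟨c, hc, hr⟩ := exists_relation_of_ord_det_pos (h.entry_mem hC) h1 hd'
  refine ⟨c, hc, h.mem_iff.2 fun j => ?_⟩
  convert hr j using 1
  have : ∑ i, const (c i) • C i = (fun i => const (c i)) ᵥ* C := (Matrix.vecMul_eq_sum _ _).symm
  rw [this, Matrix.smul_vecMul, Matrix.vecMul_vecMul]
  rfl

/-- A basis may be permuted. -/
theorem reindex (h : IsLatticeBasis Λ B) (σ : Equiv.Perm (Fin n)) :
    IsLatticeBasis Λ (fun i => B (σ i)) := by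
  have hr : Set.range (fun i => B (σ i)) = Set.range (B : Fin n → Fin n → MeroGerm) :=
    σ.surjective.range_comp (B : Fin n → Fin n → MeroGerm)
  exact ⟨h.1.comp σ σ.injective, by rw [hr]; exact h.2.1, by rw [hr]; exact h.2.2⟩

end IsLatticeBasis

theorem isLatticeBasis_span {B : Matrix (Fin n) (Fin n) MeroGerm} (h : B.det ≠ 0) :
    IsLatticeBasis (Submodule.span holo (Set.range (B : Fin n → Fin n → MeroGerm))) B := by
  have hli : LinearIndependent MeroGerm (B : Fin n → Fin n → MeroGerm) :=
    Matrix.linearIndependent_rows_iff_isUnit.2 ((Matrix.isUnit_iff_isUnit_det B).2 h.isUnit)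
  exact ⟨hli, hli.span_eq_top_of_card_eq_finrank' (by simp), rfl⟩

theorem smul_mem_of_mem_holo {N : Submodule holo (Fin n → MeroGerm)} {a : MeroGerm}
    (ha : a ∈ holo) {v : Fin n → MeroGerm} (hv : v ∈ N) : a • v ∈ N :=
  N.smul_mem ⟨a, ha⟩ hv

theorem updateRow_mem {N : Submodule holo (Fin n → MeroGerm)}
    {D : Matrix (Fin n) (Fin n) MeroGerm} (hD : ∀ i, D i ∈ N) (i : Fin n)
    {v : Fin n → MeroGerm} (hv : v ∈ N) (k : Fin n) : D.updateRow i v k ∈ N := by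
  rcases eq_or_ne k i with rfl | hk
  · exact (Matrix.updateRow_self (M := D) (i := k) (b := v)).symm ▸ hv
  · exact (Matrix.updateRow_ne (M := D) (b := v) hk).symm ▸ hD k

/-- A submodule of a lattice that contains a basis of `Kⁿ` is a lattice. -/
theorem exists_isLatticeBasis_of_le {Λ N : Submodule holo (Fin n → MeroGerm)}
    {B C : Matrix (Fin n) (Fin n) MeroGerm} (hB : IsLatticeBasis Λ B) (hN : N ≤ Λ)
    (hC : C.det ≠ 0) (hCN : ∀ i, C i ∈ N) : ∃ e, IsLatticeBasis N e := by
  -- Orders of determinants of families in `N` are bounded below by that of `B`. A family attaining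
  -- the minimum will be a basis of `N`.
  let P : ℕ → Prop := fun m => ∃ D : Matrix (Fin n) (Fin n) MeroGerm,
    D.det ≠ 0 ∧ (∀ i, D i ∈ N) ∧ ord D.det = ord B.det + m
  have hP : ∃ m, P m := by
    have := hB.ord_det_le (fun i => hN (hCN i)) hC
    exact ⟨(ord C.det - ord B.det).toNat, C, hC, hCN, by omega⟩
  classical
  obtain ⟨D, hD, hDN, hm⟩ := Nat.find_spec hP
  refine ⟨D, isLatticeBasis_iff.2 ⟨hD, fun v => ⟨fun hv i => ?_, fun hv => ?_⟩⟩⟩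
  · by_contra hi
    have hi0 : (v ᵥ* D⁻¹) i ≠ 0 := fun h => hi (h ▸ holo.zero_mem)
    have hio : ord ((v ᵥ* D⁻¹) i) < 0 := not_le.1 fun h => hi (mem_holo_of_ord h)
    have hv' : v = ∑ k, (v ᵥ* D⁻¹) k • D k := by
      rw [← Matrix.vecMul_eq_sum, Matrix.vecMul_vecMul, Matrix.nonsing_inv_mul _ hD.isUnit,
        Matrix.vecMul_one]
    -- Exchanging row `i` for `v` multiplies the determinant by the `i`-th coordinate of `v`. A pole
    -- there would contradict minimality.
    have hdet : (D.updateRow i v).det = (v ᵥ* D⁻¹) i * D.det := by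
      conv_lhs => rw [hv']
      rw [Matrix.det_updateRow_sum, smul_eq_mul]
    have h0 : (D.updateRow i v).det ≠ 0 := by rw [hdet]; exact mul_ne_zero hi0 hD
    have hmem := updateRow_mem hDN i hv
    have hle := hB.ord_det_le (fun k => hN (hmem k)) h0
    have ho : ord (D.updateRow i v).det = ord ((v ᵥ* D⁻¹) i) + ord D.det := by
      rw [hdet, ord_mul hi0 hD]
    have : (ord (D.updateRow i v).det - ord B.det).toNat < Nat.find hP := by omega
    exact Nat.find_min hP this ⟨_, h0, hmem, by omega⟩
  · have hv' : v = ∑ k, (v ᵥ* D⁻¹) k • D k := by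
      rw [← Matrix.vecMul_eq_sum, Matrix.vecMul_vecMul, Matrix.nonsing_inv_mul _ hD.isUnit,
        Matrix.vecMul_one]
    rw [hv']
    exact N.sum_mem fun k _ => smul_mem_of_mem_holo (hv k) (hDN k)

end SphereBundle

namespace SphereBundle

open MeroGerm Matrix

variable {n : ℕ}

/-! ### The distance in the affine building -/

theorem smul_submodule_le_smul {a : MeroGerm} {N N' : Submodule holo (Fin n → MeroGerm)}
    (h : N ≤ N') : a • N ≤ a • N' := Submodule.map_mono h

theorem smul_submodule_le_of_mem_holo {a : MeroGerm} (ha : a ∈ holo)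
    (N : Submodule holo (Fin n → MeroGerm)) : a • N ≤ N := by
  intro v hv
  obtain ⟨w, hw, rfl⟩ := (Submodule.mem_smul_pointwise_iff_exists _ _ _).1 hv
  exact smul_mem_of_mem_holo ha hw

theorem IsLatticeBasis.smul_le {Λ N : Submodule holo (Fin n → MeroGerm)}
    {B : Matrix (Fin n) (Fin n) MeroGerm} (hB : IsLatticeBasis Λ B) {a : MeroGerm}
    (h : ∀ i, a • B i ∈ N) : a • Λ ≤ N := by
  intro v hv
  obtain ⟨w, hw, rfl⟩ := (Submodule.mem_smul_pointwise_iff_exists _ _ _).1 hv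
  rw [← hB.2.2] at hw
  obtain ⟨c, rfl⟩ := (Submodule.mem_span_range_iff_exists_fun holo).1 hw
  rw [Finset.smul_sum]
  refine N.sum_mem fun i _ => ?_
  rw [smul_comm]
  exact N.smul_mem _ (h i)

/-- Up to homothety, `M` lies between `t^r Λ` and `Λ`. -/
def Sandwiched (r : ℕ) (Λ M : LatticeOf n) : Prop :=
  ∃ α : MeroGerm, α ≠ 0 ∧ unif ^ r • Λ.carrier ≤ α • M.carrier ∧ α • M.carrier ≤ Λ.carrier

theorem cls_eq_iff {Λ M : LatticeOf n} :
    Λ.cls = M.cls ↔ ∃ α : MeroGerm, α ≠ 0 ∧ M.carrier = α • Λ.carrier :=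
  Quotient.eq (r := homothety n)

theorem sandwiched_zero_of_cls_eq {Λ M : LatticeOf n} (h : Λ.cls = M.cls) :
    Sandwiched 0 Λ M := by
  obtain ⟨α, hα, h⟩ := cls_eq_iff.1 h
  refine ⟨α⁻¹, inv_ne_zero hα, ?_, ?_⟩ <;>
    rw [h, smul_smul, inv_mul_cancel₀ hα] <;> simp

theorem Sandwiched.trans {r s : ℕ} {Λ M N : LatticeOf n} (h : Sandwiched r Λ M)
    (h' : Sandwiched s M N) : Sandwiched (r + s) Λ N := by
  obtain ⟨α, hα, h1, h2⟩ := h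
  obtain ⟨β, hβ, h3, h4⟩ := h'
  refine ⟨α * β, mul_ne_zero hα hβ, ?_, ?_⟩
  · rw [add_comm, pow_add, mul_smul, mul_smul]
    refine (smul_submodule_le_smul h1).trans ?_
    rw [smul_comm]
    exact smul_submodule_le_smul h3
  · rw [mul_smul]
    exact (smul_submodule_le_smul h4).trans h2

/-- Both orientations are needed because `SimpleGraph.fromRel` symmetrises the relation. The reverse
sandwich is `t M' ⊆ t Λ' ⊆ M'`, with scalar `unif`. -/
theorem sandwiched_one_of_rel {Λ M Λ' M' : LatticeOf n} (h1 : Λ'.cls = Λ.cls)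
    (h2 : M'.cls = M.cls) (h : unif • Λ'.carrier ≤ M'.carrier) (h' : M'.carrier ≤ Λ'.carrier) :
    Sandwiched 1 Λ M ∧ Sandwiched 1 M Λ := by
  have h3 : Sandwiched 1 Λ' M' := ⟨1, one_ne_zero, by simpa only [pow_one, one_smul] using h,
      by simpa only [one_smul] using h'⟩
  have h4 : Sandwiched 1 M' Λ' :=
    ⟨unif, unif_ne_zero, by simpa only [pow_one] using smul_submodule_le_smul h', h⟩
  have h5 := ((sandwiched_zero_of_cls_eq h1.symm).trans h3).trans (sandwiched_zero_of_cls_eq h2)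
  have h6 := ((sandwiched_zero_of_cls_eq h2.symm).trans h4).trans (sandwiched_zero_of_cls_eq h1)
  rw [zero_add, add_zero] at h5 h6
  exact ⟨h5, h6⟩

theorem sandwiched_of_walk {u v : Vertex n} (p : (buildingGraph n).Walk u v) :
    ∀ Λ M : LatticeOf n, Λ.cls = u → M.cls = v → Sandwiched p.length Λ M := by
  induction p with
  | nil => exact fun Λ M h h' => sandwiched_zero_of_cls_eq (h.trans h'.symm)
  | @cons u w v hadj p ih =>
    intro Λ M h h'
    obtain ⟨N, rfl⟩ : ∃ N : LatticeOf n, N.cls = w := Quotient.exists_rep w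
    have h1 : Sandwiched 1 Λ N := by
      obtain ⟨-, ⟨A, B, hA, hB, h3, h4⟩ | ⟨A, B, hA, hB, h3, h4⟩⟩ := hadj
      · exact (sandwiched_one_of_rel (hA.trans h.symm) hB h3 h4).1
      · exact (sandwiched_one_of_rel hA (hB.trans h.symm) h3 h4).2
    rw [SimpleGraph.Walk.length_cons, add_comm]
    exact h1.trans (ih N M rfl h')

/-- The lattices `M + t^i Λ` between `M` and `Λ`. -/
theorem exists_lattice_sup (Λ M : LatticeOf n) (h : M.carrier ≤ Λ.carrier) (i : ℕ) :
    ∃ N : LatticeOf n, N.carrier = M.carrier ⊔ unif ^ i • Λ.carrier := by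
  obtain ⟨B, hB⟩ := Λ.exists_matrix
  obtain ⟨C, hC⟩ := M.exists_matrix
  obtain ⟨e, he⟩ := exists_isLatticeBasis_of_le (N := M.carrier ⊔ unif ^ i • Λ.carrier) hB
    (sup_le h (smul_submodule_le_of_mem_holo (holo.pow_mem unif_mem_holo i) _)) hC.det_ne_zero
    fun i => Submodule.mem_sup_left (hC.row_mem i)
  exact ⟨⟨_, e, he⟩, rfl⟩

/-- Along the chain `M + t^i Λ`, consecutive classes are equal or adjacent. Equal ones cost no edge,
hence only an inequality for the length. -/
theorem exists_walk_of_le {Λ M : LatticeOf n} (h : M.carrier ≤ Λ.carrier) (r : ℕ) :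
    ∀ N : LatticeOf n, N.carrier = M.carrier ⊔ unif ^ r • Λ.carrier →
      ∃ p : (buildingGraph n).Walk Λ.cls N.cls, p.length ≤ r := by
  induction r with
  | zero =>
    intro N hN
    have : Λ.cls = N.cls := cls_eq_iff.2 ⟨1, one_ne_zero, by
      rw [hN, pow_zero, one_smul, sup_eq_right.2 h]⟩
    exact ⟨SimpleGraph.Walk.nil.copy rfl this, by simp⟩
  | succ r ih =>
    intro N hN
    obtain ⟨N', hN'⟩ := exists_lattice_sup Λ M h r
    obtain ⟨p, hp⟩ := ih N' hN'
    by_cases he : N'.cls = N.cls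
    · exact ⟨p.copy rfl he, by rw [SimpleGraph.Walk.length_copy]; omega⟩
    · have hadj : (buildingGraph n).Adj N'.cls N.cls := by
        refine ⟨he, Or.inl ⟨N', N, rfl, rfl, ?_, ?_⟩⟩
        · rw [hN, hN', Submodule.smul_sup', smul_smul, pow_succ']
          exact sup_le_sup_right (smul_submodule_le_of_mem_holo unif_mem_holo _) _
        · rw [hN, hN', pow_succ', mul_smul]
          exact sup_le_sup_left (smul_submodule_le_of_mem_holo unif_mem_holo _) _
      exact ⟨p.concat hadj, by rw [SimpleGraph.Walk.length_concat]; omega⟩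

theorem exists_walk_of_sandwiched {r : ℕ} {Λ M : LatticeOf n} (h : Sandwiched r Λ M) :
    ∃ p : (buildingGraph n).Walk Λ.cls M.cls, p.length ≤ r := by
  obtain ⟨α, hα, h1, h2⟩ := h
  obtain ⟨C, hC⟩ := M.exists_matrix
  obtain ⟨B, hB⟩ := Λ.exists_matrix
  have hdet : (scaleRows (fun _ => α) C).det ≠ 0 :=
    det_scaleRows_ne_zero (fun _ => hα) hC.det_ne_zero
  obtain ⟨e, he⟩ := exists_isLatticeBasis_of_le hB h2 hdet
    fun i => Submodule.smul_mem_pointwise_smul _ _ _ (hC.row_mem i)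
  let M' : LatticeOf n := ⟨α • M.carrier, e, he⟩
  have hM : M.cls = M'.cls := cls_eq_iff.2 ⟨α, hα, rfl⟩
  rw [hM]
  exact exists_walk_of_le (M := M') h2 r M' (sup_eq_left.2 h1).symm

theorem buildingDist_le {r : ℕ} {Λ M : LatticeOf n} (h : Sandwiched r Λ M) :
    buildingDist Λ M ≤ r := by
  obtain ⟨p, hp⟩ := exists_walk_of_sandwiched h
  exact (SimpleGraph.dist_le p).trans hp

/-- A multiple of a lattice is contained in another one. -/
theorem exists_unif_pow_smul_le (Λ M : LatticeOf n) :
    ∃ N : ℕ, unif ^ N • M.carrier ≤ Λ.carrier := by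
  obtain ⟨B, hB⟩ := Λ.exists_matrix
  obtain ⟨C, hC⟩ := M.exists_matrix
  -- A crude bound for all pole orders in the matrix expressing `C` in terms of `B`.
  let N : ℕ := ∑ i, ∑ j, (ord ((C * B⁻¹) i j)).natAbs
  refine ⟨N, ?_⟩
  have hrow (i : Fin n) : unif ^ N • C i ∈ Λ.carrier := by
    refine hB.mem_iff.2 fun j => ?_
    rw [Matrix.smul_vecMul, Pi.smul_apply, smul_eq_mul, ← Matrix.mul_apply_eq_vecMul]
    by_cases h0 : (C * B⁻¹) i j = 0
    · rw [h0, mul_zero]; exact holo.zero_mem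
    have h1 : (ord ((C * B⁻¹) i j)).natAbs ≤ N :=
      (Finset.single_le_sum (f := fun j => (ord ((C * B⁻¹) i j)).natAbs)
        (fun _ _ => Nat.zero_le _) (Finset.mem_univ j)).trans
      (Finset.single_le_sum (f := fun i => ∑ j, (ord ((C * B⁻¹) i j)).natAbs)
        (fun _ _ => Nat.zero_le _) (Finset.mem_univ i))
    refine mem_holo_of_ord ?_
    rw [ord_mul (pow_ne_zero _ unif_ne_zero) h0, ← zpow_natCast, ord_unif_zpow]
    omega
  exact hC.smul_le hrow

/-- This yields connectedness of the building graph. Without it `SimpleGraph.dist` could take its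
default value `0` and say nothing about paths. -/
theorem exists_sandwiched (Λ M : LatticeOf n) : ∃ r, Sandwiched r Λ M := by
  obtain ⟨a, ha⟩ := exists_unif_pow_smul_le Λ M
  obtain ⟨b, hb⟩ := exists_unif_pow_smul_le M Λ
  refine ⟨a + b, unif ^ a, pow_ne_zero _ unif_ne_zero, ?_, ha⟩
  rw [pow_add, mul_smul]
  exact smul_submodule_le_smul hb

theorem sandwiched_buildingDist (Λ M : LatticeOf n) : Sandwiched (buildingDist Λ M) Λ M := by
  obtain ⟨r, hr⟩ := exists_sandwiched Λ M
  obtain ⟨p, -⟩ := exists_walk_of_sandwiched hr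
  obtain ⟨q, hq⟩ := p.reachable.exists_walk_length_eq_dist
  have := sandwiched_of_walk q Λ M rfl rfl
  rwa [hq] at this

end SphereBundle

namespace SphereBundle

open MeroGerm Filter

variable {n : ℕ}

/-! ### Local coordinates on the sphere -/

theorem localParam_coe (p t : ℂ) : localParam (p : OnePoint ℂ) t = ((p + t : ℂ) : OnePoint ℂ) := rfl

theorem localParam_infty_of_ne {t : ℂ} (ht : t ≠ 0) :
    localParam OnePoint.infty t = ((t⁻¹ : ℂ) : OnePoint ℂ) := if_neg ht

theorem localParam_zero (x : OnePoint ℂ) : localParam x 0 = x := by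
  induction x using OnePoint.rec with
  | infty => exact if_pos rfl
  | coe p => rw [localParam_coe, add_zero]

/-- The germ at a nearby point is taken in that point's own chart. This change of chart transports
analyticity from the chart at `x`. -/
theorem exists_transition (x : OnePoint ℂ) {t₀ : ℂ} (h : t₀ ≠ 0) :
    ∃ ψ : ℂ → ℂ, AnalyticAt ℂ ψ 0 ∧ ψ 0 = t₀ ∧
      ∀ᶠ s in 𝓝 (0 : ℂ), localParam (localParam x t₀) s = localParam x (ψ s) := by
  induction x using OnePoint.rec with
  | infty =>
    have ha : AnalyticAt ℂ (fun s : ℂ => (t₀⁻¹ + s)⁻¹) 0 :=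
      (analyticAt_const.add analyticAt_id).inv (by simpa using h)
    refine ⟨_, ha, by simp, ?_⟩
    have hc : ContinuousAt (fun s : ℂ => (t₀⁻¹ + s)⁻¹) 0 := ha.continuousAt
    filter_upwards [hc.eventually_ne (by simpa using h : (fun s : ℂ => (t₀⁻¹ + s)⁻¹) 0 ≠ 0)]
      with s hs
    rw [localParam_infty_of_ne h, localParam_infty_of_ne hs, localParam_coe, inv_inv]
  | coe p =>
    refine ⟨fun s => t₀ + s, analyticAt_const.add analyticAt_id, by simp, ?_⟩
    filter_upwards with s
    rw [localParam_coe, localParam_coe, localParam_coe, add_assoc]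

theorem exists_analytic_germ {f : OnePoint ℂ → ℂ} {F : ℂ → ℂ} {x : OnePoint ℂ} {t₀ : ℂ}
    (h : t₀ ≠ 0) (hF : AnalyticAt ℂ F t₀) (hf : ∀ᶠ t in 𝓝 t₀, f (localParam x t) = F t) :
    ∃ G : ℂ → ℂ, AnalyticAt ℂ G 0 ∧ G 0 = F t₀ ∧
      (fun s => f (localParam (localParam x t₀) s)) =ᶠ[𝓝[≠] 0] G := by
  obtain ⟨ψ, hψ, hψ0, hψx⟩ := exists_transition x h
  refine ⟨F ∘ ψ, AnalyticAt.comp (by rwa [hψ0]) hψ, by simp [hψ0], ?_⟩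
  have hc : Tendsto ψ (𝓝 0) (𝓝 t₀) := hψ0 ▸ hψ.continuousAt
  filter_upwards [nhdsWithin_le_nhds hψx, nhdsWithin_le_nhds (hc.eventually hf)] with s h1 h2
  rw [h1, h2, Function.comp]

/-- At infinity, punctured neighbourhoods are the filter of complements of bounded sets of `ℂ`,
which inversion exchanges with the punctured neighbourhoods of `0`. -/
theorem map_localParam (x : OnePoint ℂ) : map (localParam x) (𝓝[≠] 0) = 𝓝[≠] x := by
  induction x using OnePoint.rec with
  | infty =>
    rw [OnePoint.nhdsNE_infty_eq, coclosedCompact_eq_cocompact, ← Metric.cobounded_eq_cocompact,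
      ← inv_nhdsNE_zero, ← Filter.map_inv, map_map]
    refine Filter.map_congr ?_
    filter_upwards [self_mem_nhdsWithin] with t ht
    exact localParam_infty_of_ne ht
  | coe p =>
    have hp : ((↑) : ℂ → OnePoint ℂ) ⁻¹' {(p : OnePoint ℂ)}ᶜ = {p}ᶜ := by
      ext z
      simp
    have h0 := (Homeomorph.addLeft p).map_punctured_nhds_eq 0
    simp only [Homeomorph.coe_addLeft, add_zero] at h0
    rw [OnePoint.nhdsWithin_coe, hp, ← h0, map_map]
    rfl

/-! ### Global meromorphic functions -/

/-- The ring of functions on the sphere that are meromorphic everywhere. -/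
def GlobalMero : Subring (OnePoint ℂ → ℂ) where
  carrier := {f | ∀ y, MeromorphicAt (fun t => f (localParam y t)) 0}
  mul_mem' hf hg y := (hf y).mul (hg y)
  one_mem' _ := MeromorphicAt.const 1 0
  add_mem' hf hg y := (hf y).add (hg y)
  zero_mem' _ := MeromorphicAt.const 0 0
  neg_mem' hf y := (hf y).neg

/-- The germ at `y` of a global meromorphic function. -/
def germAt (y : OnePoint ℂ) : GlobalMero →+* MeroGerm where
  toFun f := mk (fun t => f.1 (localParam y t)) (f.2 y)
  map_one' := rfl
  map_mul' _ _ := rfl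
  map_zero' := rfl
  map_add' _ _ := rfl

theorem germAt_eq_mk (f : GlobalMero) (y : OnePoint ℂ) {g : ℂ → ℂ} (hg : MeromorphicAt g 0)
    (h : ∀ᶠ t in 𝓝[≠] (0 : ℂ), f.1 (localParam y t) = g t) : germAt y f = mk g hg :=
  (mk_eq_mk (hf := f.2 y)).2 h

theorem mk_eq_zero_of_eventually {f : ℂ → ℂ} (hf : MeromorphicAt f 0)
    (h : ∀ᶠ t in 𝓝[≠] (0 : ℂ), f t = 0) : mk f hf = 0 :=
  (mk_eq_mk (hg := MeromorphicAt.const 0 0)).2 h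

/-- The constant functions. -/
def cst : ℂ →+* GlobalMero where
  toFun c := ⟨fun _ => c, fun _ => MeromorphicAt.const c 0⟩
  map_one' := rfl
  map_mul' _ _ := rfl
  map_zero' := rfl
  map_add' _ _ := rfl

theorem germAt_cst (y : OnePoint ℂ) (c : ℂ) : germAt y (cst c) = const c := rfl

/-- Integer powers of global meromorphic functions. -/
def globalZPow (f : GlobalMero) (m : ℤ) : GlobalMero :=
  ⟨fun y => f.1 y ^ m, fun y => (f.2 y).zpow m⟩

theorem germAt_inv (y : OnePoint ℂ) (f : GlobalMero) :
    germAt y (globalZPow f (-1)) = (germAt y f)⁻¹ := by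
  by_cases h : germAt y f = 0
  · rw [h, inv_zero]
    have h' : mk _ (f.2 y) = mk (fun _ => 0) (MeromorphicAt.const 0 0) := h
    refine mk_eq_zero_of_eventually ((globalZPow f (-1)).2 y) ((mk_eq_mk.1 h').mono fun t ht => ?_)
    change f.1 (localParam y t) ^ (-1 : ℤ) = 0
    rw [show f.1 (localParam y t) = 0 from ht]
    simp
  · refine eq_inv_of_mul_eq_one_left ?_
    have h1 : ∀ᶠ t in 𝓝[≠] (0 : ℂ), f.1 (localParam y t) ≠ 0 :=
      ((f.2 y).eventually_eq_zero_or_eventually_ne_zero).resolve_left fun h0 =>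
        h (mk_eq_zero_of_eventually (f.2 y) h0)
    rw [← map_mul]
    refine germAt_eq_mk _ _ (MeromorphicAt.const 1 0) (h1.mono fun t ht => ?_)
    change f.1 (localParam y t) ^ (-1 : ℤ) * f.1 (localParam y t) = 1
    rw [zpow_neg_one, inv_mul_cancel₀ ht]

theorem germAt_zpow (y : OnePoint ℂ) (f : GlobalMero) (m : ℤ) :
    germAt y (globalZPow f m) = germAt y f ^ m := by
  obtain ⟨k, rfl | rfl⟩ := m.eq_nat_or_neg
  · have : globalZPow f k = f ^ k := Subtype.ext (funext fun z => zpow_natCast _ _)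
    rw [this, map_pow, zpow_natCast]
  · have : globalZPow f (-k) = (globalZPow f (-1)) ^ k := by
      refine Subtype.ext (funext fun z => ?_)
      change f.1 z ^ (-k : ℤ) = (f.1 z ^ (-1 : ℤ)) ^ k
      rw [← zpow_natCast, ← zpow_mul]
      simp
    rw [this, map_pow, germAt_inv, inv_pow, zpow_neg, zpow_natCast]

/-- The function `z - p`. -/
def coord (p : ℂ) : GlobalMero :=
  ⟨fun y => y.elim 0 fun z => z - p, fun y => by
    induction y using OnePoint.rec with
    | infty =>
      have : MeromorphicAt (fun t : ℂ => t⁻¹ - p) 0 := by fun_prop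
      refine this.congr ?_
      filter_upwards [self_mem_nhdsWithin] with t ht
      rw [localParam_infty_of_ne ht]
      rfl
    | coe q =>
      have : MeromorphicAt (fun t : ℂ => q + t - p) 0 := by fun_prop
      exact this⟩

theorem germAt_coord_self (p : ℂ) : germAt p (coord p) = unif := by
  refine germAt_eq_mk _ _ (MeromorphicAt.id 0) (Filter.Eventually.of_forall fun t => ?_)
  change p + t - p = t
  ring

theorem germAt_coord_coe (p q : ℂ) : germAt q (coord p) = const (q - p) + unif := by
  refine germAt_eq_mk _ _ ((MeromorphicAt.const (q - p) 0).add (MeromorphicAt.id 0))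
    (Filter.Eventually.of_forall fun t => ?_)
  change q + t - p = (q - p) + t
  ring

theorem germAt_coord_infty (p : ℂ) : germAt OnePoint.infty (coord p) = unif⁻¹ - const p := by
  have h : germAt OnePoint.infty (coord p) * unif = 1 - const p * unif := by
    refine (mk_eq_mk (hf := ((coord p).2 OnePoint.infty).mul (MeromorphicAt.id 0))
      (hg := (MeromorphicAt.const 1 0).sub ((MeromorphicAt.const p 0).mul (MeromorphicAt.id 0)))).2 ?_
    filter_upwards [self_mem_nhdsWithin] with t ht
    change (coord p).1 (localParam OnePoint.infty t) * t = 1 - p * t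
    rw [localParam_infty_of_ne ht]
    change (t⁻¹ - p) * t = 1 - p * t
    rw [sub_mul, inv_mul_cancel₀ ht]
  rw [eq_div_of_mul_eq unif_ne_zero h]
  field_simp [unif_ne_zero]

/-- The residue is `c ≠ 0`, so the germ is a unit. -/
theorem ord_const_add_unif_mul {c : ℂ} (hc : c ≠ 0) {u : MeroGerm} (hu : u ∈ holo) :
    const c + unif * u ≠ 0 ∧ ord (const c + unif * u) = 0 := by
  have hm : unif * u ∈ holo := holo.mul_mem unif_mem_holo hu
  have hmem : const c + unif * u ∈ holo := holo.add_mem (const_mem_holo c) hm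
  have hres : res ⟨const c + unif * u, hmem⟩ ≠ 0 := by
    have : (⟨_, hmem⟩ : holo) = ⟨_, const_mem_holo c⟩ + ⟨unif * u, hm⟩ := rfl
    rw [this, map_add, res_const, res_eq_zero_of_mem hm (by
      rwa [inv_mul_cancel_left₀ unif_ne_zero]), add_zero]
    exact hc
  have h0 : const c + unif * u ≠ 0 := by
    intro h
    apply hres
    have : (⟨_, hmem⟩ : holo) = 0 := Subtype.ext h
    rw [this, map_zero]
  refine ⟨h0, le_antisymm (not_lt.1 fun h => hres ?_) (ord_nonneg_of_mem hmem h0)⟩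
  refine res_eq_zero_of_mem hmem (mem_holo_of_ord ?_)
  rw [ord_mul (inv_ne_zero unif_ne_zero) h0, ord_inv unif_ne_zero, ord_unif]
  omega

theorem germAt_coord_of_ne {p q : ℂ} (h : q ≠ p) :
    germAt q (coord p) ≠ 0 ∧ ord (germAt q (coord p)) = 0 := by
  rw [germAt_coord_coe]
  simpa using ord_const_add_unif_mul (sub_ne_zero.2 h) holo.one_mem

theorem ord_germAt_coord_infty (p : ℂ) :
    germAt OnePoint.infty (coord p) ≠ 0 ∧ ord (germAt OnePoint.infty (coord p)) = -1 := by
  obtain ⟨h0, h1⟩ := ord_const_add_unif_mul one_ne_zero (const_mem_holo (-p))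
  have : germAt OnePoint.infty (coord p) = unif⁻¹ * (const 1 + unif * const (-p)) := by
    rw [germAt_coord_infty, map_one, map_neg]
    field_simp [unif_ne_zero]
    ring
  rw [this, ord_mul (inv_ne_zero unif_ne_zero) h0, h1, ord_inv unif_ne_zero, ord_unif]
  exact ⟨mul_ne_zero (inv_ne_zero unif_ne_zero) h0, rfl⟩

theorem germAt_coord_ne_zero (y : OnePoint ℂ) (p : ℂ) : germAt y (coord p) ≠ 0 := by
  induction y using OnePoint.rec with
  | infty => exact (ord_germAt_coord_infty p).1
  | coe q =>
    rcases eq_or_ne q p with rfl | h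
    · rw [germAt_coord_self]; exact unif_ne_zero
    · exact (germAt_coord_of_ne h).1

/-! ### Liouville's theorem on the sphere -/

/-- The value at `y` of an everywhere holomorphic function. -/
def valueAt {g : GlobalMero} (hg : ∀ y, germAt y g ∈ holo) (y : OnePoint ℂ) : ℂ :=
  res ⟨germAt y g, hg y⟩

/-- The raw values of `g` may be wrong at isolated points. The corrected function `valueAt` is
analytic in every chart, without exceptional points. -/
theorem exists_valueAt_eq {g : GlobalMero} (hg : ∀ y, germAt y g ∈ holo) (x : OnePoint ℂ) :
    ∃ φ : ℂ → ℂ, AnalyticAt ℂ φ 0 ∧ φ 0 = valueAt hg x ∧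
      (∀ᶠ t in 𝓝 (0 : ℂ), valueAt hg (localParam x t) = φ t) ∧
      ∀ᶠ t in 𝓝[≠] (0 : ℂ), g.1 (localParam x t) = φ t := by
  have hval {y : OnePoint ℂ} {G : ℂ → ℂ} (hG : AnalyticAt ℂ G 0)
      (h : (fun s => g.1 (localParam y s)) =ᶠ[𝓝[≠] 0] G) : valueAt hg y = G 0 := by
    have h1 : germAt y g = mk G hG.meromorphicAt := germAt_eq_mk g y _ h
    have h2 : (⟨germAt y g, hg y⟩ : holo) = ⟨mk G hG.meromorphicAt, mk_mem_holo hG⟩ :=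
      Subtype.ext h1
    rw [valueAt, h2, res_mk hG]
  obtain ⟨φ, hφ, h⟩ := exists_eq_mk_of_mem_holo (hg x)
  have he : (fun t => g.1 (localParam x t)) =ᶠ[𝓝[≠] 0] φ := ((mk_eq_mk (hg := g.2 x)).1 h).symm
  have h0 : valueAt hg x = φ 0 := hval hφ he
  refine ⟨φ, hφ, h0.symm, ?_, he⟩
  -- Near a point `t ≠ 0` the puncture is invisible, so `g` agrees with `φ` on a full neighbourhood
  -- of `t`, as `exists_analytic_germ` requires.
  have h1 : ∀ᶠ t in 𝓝[≠] (0 : ℂ), ∀ᶠ s in 𝓝 t, g.1 (localParam x s) = φ s := by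
    filter_upwards [eventually_eventually_nhdsWithin.2 he, self_mem_nhdsWithin] with t ht ht0
    rwa [isOpen_compl_singleton.nhdsWithin_eq ht0] at ht
  rw [eventually_nhdsWithin_iff] at h1
  filter_upwards [h1, hφ.eventually_analyticAt] with t ht hφt
  rcases eq_or_ne t 0 with rfl | ht0
  · rw [localParam_zero, h0]
  · obtain ⟨G, hG, hG0, hGe⟩ := exists_analytic_germ ht0 hφt (ht ht0)
    rw [hval hG hGe, hG0]

/-- On `ℂ` the function `valueAt hg` is entire, and it tends to its value at infinity; Liouville's
theorem applies. -/
theorem valueAt_eq {g : GlobalMero} (hg : ∀ y, germAt y g ∈ holo) (x : OnePoint ℂ) :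
    valueAt hg x = valueAt hg OnePoint.infty := by
  induction x using OnePoint.rec with
  | infty => rfl
  | coe p =>
    let h : ℂ → ℂ := fun z => valueAt hg z
    have hd : Differentiable ℂ h := by
      intro q
      obtain ⟨φ, hφ, -, hv, -⟩ := exists_valueAt_eq hg q
      have ht : Tendsto (fun z : ℂ => z - q) (𝓝 q) (𝓝 0) := by
        have : ContinuousAt (fun z : ℂ => z - q) q := by fun_prop
        simpa [ContinuousAt] using this
      have he : h =ᶠ[𝓝 q] fun z => φ (z - q) := by
        filter_upwards [ht.eventually hv] with z hz
        rw [← hz, localParam_coe, add_sub_cancel]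
      have hφ' : DifferentiableAt ℂ φ (q - q) := by
        rw [sub_self]; exact hφ.differentiableAt
      have hs : DifferentiableAt ℂ (fun z : ℂ => z - q) q := by fun_prop
      exact (DifferentiableAt.comp (g := φ) (f := fun z => z - q) q hφ' hs).congr_of_eventuallyEq he
    refine hd.apply_eq_of_tendsto_cocompact p ?_
    obtain ⟨φ, hφ, h0, hv, -⟩ := exists_valueAt_eq hg OnePoint.infty
    rw [← Metric.cobounded_eq_cocompact, ← h0]
    have ht : Tendsto (fun z : ℂ => z⁻¹) (Bornology.cobounded ℂ) (𝓝[≠] 0) := by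
      rw [← Filter.inv_cobounded₀]
      exact tendsto_map
    refine ((hφ.continuousAt.tendsto.comp (ht.mono_right nhdsWithin_le_nhds))).congr' ?_
    filter_upwards [ht.eventually (nhdsWithin_le_nhds hv), ht.eventually self_mem_nhdsWithin]
      with z hz hz0
    rw [Function.comp, ← hz, localParam_infty_of_ne hz0, inv_inv]

theorem germAt_eq_zero_of_valueAt {g : GlobalMero} (hg : ∀ y, germAt y g ∈ holo)
    {x : OnePoint ℂ} (h : valueAt hg x = 0) : germAt x g = 0 := by
  obtain ⟨φ, hφ, -, hv, he⟩ := exists_valueAt_eq hg x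
  refine germAt_eq_mk g x (MeromorphicAt.const 0 0) ?_
  filter_upwards [he, nhdsWithin_le_nhds hv] with t h1 h2
  rw [h1, ← h2, valueAt_eq, ← valueAt_eq hg x, h]

/-- A global meromorphic function without poles outside `x` does not vanish at `x`. -/
theorem ord_germAt_nonpos {g : GlobalMero} {x : OnePoint ℂ}
    (hg : ∀ y, y ≠ x → germAt y g ∈ holo) (h0 : germAt x g ≠ 0) : ord (germAt x g) ≤ 0 := by
  by_contra! h
  have hx : germAt x g ∈ holo := mem_holo_of_ord h.le
  have hg' : ∀ y, germAt y g ∈ holo := fun y => by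
    rcases eq_or_ne y x with rfl | hy
    exacts [hx, hg y hy]
  refine h0 (germAt_eq_zero_of_valueAt hg' (res_eq_zero_of_mem hx (mem_holo_of_ord ?_)))
  rw [ord_mul (inv_ne_zero unif_ne_zero) h0, ord_inv unif_ne_zero, ord_unif]
  omega

/-! ### A bundle coincides with the standard one outside finitely many points -/

/-- The functions meromorphic at `0`. -/
def meroAtZero : Subring (ℂ → ℂ) where
  carrier := {f | MeromorphicAt f 0}
  mul_mem' hf hg := MeromorphicAt.mul hf hg
  one_mem' := MeromorphicAt.const 1 0
  add_mem' hf hg := MeromorphicAt.add hf hg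
  zero_mem' := MeromorphicAt.const 0 0
  neg_mem' hf := MeromorphicAt.neg hf

/-- The germ of a function meromorphic at `0`, as a ring homomorphism. -/
def meroAtZero.toGerm : meroAtZero →+* MeroGerm where
  toFun f := mk f.1 f.2
  map_one' := rfl
  map_mul' _ _ := rfl
  map_zero' := rfl
  map_add' _ _ := rfl

/-- A frame of meromorphic functions is eventually holomorphic and invertible. -/
theorem eventually_isLatticeBasis_one (E : VBundle n) (x : OnePoint ℂ) :
    ∀ᶠ y in 𝓝[≠] x, IsLatticeBasis (E.stalk y) (1 : Matrix (Fin n) (Fin n) MeroGerm) := by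
  obtain ⟨U, hU, hxU, e, he⟩ := E.locallyFree x
  have hUe : ∀ᶠ y in 𝓝[≠] x, y ∈ U := nhdsWithin_le_nhds (hU.mem_nhds hxU)
  rw [← map_localParam, eventually_map] at hUe ⊢
  let F : Fin n → Fin n → ℂ → ℂ := fun i j t => (e i j).1 (localParam x t)
  have hF : ∀ i j, MeromorphicAt (F i j) 0 := fun i j => (e i j).2 x hxU
  let A : Matrix (Fin n) (Fin n) meroAtZero := fun i j => ⟨F i j, hF i j⟩
  have hA : meroAtZero.toGerm A.det ≠ 0 := by
    rw [RingHom.map_det]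
    exact (he x hxU).det_ne_zero
  have hA' : ∀ᶠ t in 𝓝[≠] (0 : ℂ), A.det.1 t ≠ 0 :=
    (A.det.2.eventually_eq_zero_or_eventually_ne_zero).resolve_left fun h =>
      hA (mk_eq_zero_of_eventually A.det.2 h)
  have han : ∀ᶠ t in 𝓝[≠] (0 : ℂ), ∀ i j, AnalyticAt ℂ (F i j) t :=
    eventually_all.2 fun i => eventually_all.2 fun j => (hF i j).eventually_analyticAt
  filter_upwards [hUe, hA', han, self_mem_nhdsWithin] with t htU hdet hant ht0
  choose G hG hG0 hGe using fun i j => exists_analytic_germ (f := (e i j).1) (x := x) ht0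
    (hant i j) (Eventually.of_forall fun _ => rfl)
  let B : Matrix (Fin n) (Fin n) MeroGerm := fun i => germVec (e i) (localParam x t) htU
  have hB : IsLatticeBasis (E.stalk (localParam x t)) B := he _ htU
  have hBG (i j) : B i j = mk (G i j) (hG i j).meromorphicAt :=
    (mk_eq_mk (hf := (e i j).2 _ htU)).2 (hGe i j)
  have hBh (i j) : B i j ∈ holo := hBG i j ▸ mk_mem_holo (hG i j)
  have hev : A.det.1 t = Matrix.det (Matrix.of fun i j => F i j t) :=
    RingHom.map_det ((Pi.evalRingHom (fun _ : ℂ => ℂ) t).comp meroAtZero.subtype) A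
  have hres : res (holoLift B hBh).det ≠ 0 := by
    rw [RingHom.map_det]
    have : res.mapMatrix (holoLift B hBh) = Matrix.of fun i j => F i j t := by
      ext i j
      have h1 : holoLift B hBh i j = ⟨mk (G i j) (hG i j).meromorphicAt, mk_mem_holo (hG i j)⟩ :=
        Subtype.ext (hBG i j)
      change res (holoLift B hBh i j) = F i j t
      rw [h1, res_mk (hG i j), hG0]
    rw [this, ← hev]
    exact hdet
  have hdB : B.det = ((holoLift B hBh).det : holo) :=
    (RingHom.map_det holo.subtype (holoLift B hBh)).symm
  have hord : ord B.det = 0 := by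
    refine le_antisymm (not_lt.1 fun h => hres ?_)
      (ord_nonneg_of_mem (det_mem_holo hBh) hB.det_ne_zero)
    refine res_eq_zero_of_mem (a := ((holoLift B hBh).det : holo)) (Subtype.property _) ?_
    rw [← hdB]
    refine mem_holo_of_ord ?_
    rw [ord_mul (inv_ne_zero unif_ne_zero) hB.det_ne_zero, ord_inv unif_ne_zero, ord_unif]
    omega
  -- Now `B` is invertible over the holomorphic germs, so the standard basis generates the same
  -- lattice as its rows.
  refine hB.of_ord_det (fun i => hB.mem_iff.2 fun j => ?_) ?_ ?_
  · have : (1 : Matrix (Fin n) (Fin n) MeroGerm).row i ᵥ* B⁻¹ = B⁻¹.row i := by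
      rw [Matrix.row, ← Matrix.mul_apply_eq_vecMul, one_mul]; rfl
    exact (congrFun this j).symm ▸ inv_mem_holo hBh hB.det_ne_zero hord i j
  · rw [Matrix.det_one]; exact one_ne_zero
  · rw [Matrix.det_one, ord_one, hord]

/-- The sphere is compact: infinitely many bad points would accumulate somewhere, against
`eventually_isLatticeBasis_one`. -/
theorem finite_not_isLatticeBasis_one (E : VBundle n) :
    {y | ¬ IsLatticeBasis (E.stalk y) (1 : Matrix (Fin n) (Fin n) MeroGerm)}.Finite := by
  by_contra h
  obtain ⟨x, hx⟩ := Set.Infinite.exists_accPt_principal h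
  rw [accPt_iff_frequently_nhdsNE] at hx
  exact hx (by simpa using eventually_isLatticeBasis_one E x)

end SphereBundle

namespace SphereBundle

open MeroGerm

variable {n : ℕ}

/-! ### Matrices of global meromorphic functions -/

/-- The matrix of germs at `y`. -/
def germMat (y : OnePoint ℂ) (S : Matrix (Fin n) (Fin n) GlobalMero) :
    Matrix (Fin n) (Fin n) MeroGerm := (germAt y).mapMatrix S

theorem det_germMat (y : OnePoint ℂ) (S : Matrix (Fin n) (Fin n) GlobalMero) :
    (germMat y S).det = germAt y S.det := (RingHom.map_det _ _).symm

theorem germMat_scaleRows (y : OnePoint ℂ) (d : Fin n → GlobalMero)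
    (S : Matrix (Fin n) (Fin n) GlobalMero) :
    germMat y (scaleRows d S) = scaleRows (fun i => germAt y (d i)) (germMat y S) := by
  ext i j
  exact map_mul (germAt y) _ _

/-- Replace the row `i` of `S` by the combination of its rows with coefficients `r`. -/
def replaceRow {R : Type*} [CommRing R] (S : Matrix (Fin n) (Fin n) R) (i : Fin n)
    (r : Fin n → R) : Matrix (Fin n) (Fin n) R := S.updateRow i (∑ k, r k • S k)

theorem det_replaceRow {R : Type*} [CommRing R] (S : Matrix (Fin n) (Fin n) R) (i : Fin n)
    (r : Fin n → R) : (replaceRow S i r).det = r i * S.det := Matrix.det_updateRow_sum S i r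

theorem germMat_replaceRow (y : OnePoint ℂ) (S : Matrix (Fin n) (Fin n) GlobalMero) (i : Fin n)
    (r : Fin n → GlobalMero) :
    germMat y (replaceRow S i r) = replaceRow (germMat y S) i (fun k => germAt y (r k)) := by
  ext a b
  rcases eq_or_ne a i with rfl | h
  · simp [germMat, replaceRow, Finset.sum_apply]
  · simp [germMat, replaceRow, Matrix.updateRow_ne h]

theorem replaceRow_mem {N : Submodule holo (Fin n → MeroGerm)}
    {S : Matrix (Fin n) (Fin n) MeroGerm} (hS : ∀ i, S i ∈ N) (i : Fin n) {r : Fin n → MeroGerm}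
    (hr : ∑ k, r k • S k ∈ N) (k : Fin n) : replaceRow S i r k ∈ N :=
  updateRow_mem hS i hr k

theorem IsLatticeBasis.replaceRow {Λ : Submodule holo (Fin n → MeroGerm)}
    {B : Matrix (Fin n) (Fin n) MeroGerm} (hB : IsLatticeBasis Λ B) {i : Fin n}
    {r : Fin n → MeroGerm} (hr : ∀ k, r k ∈ holo) (h0 : r i ≠ 0) (h1 : ord (r i) = 0) :
    IsLatticeBasis Λ (SphereBundle.replaceRow B i r) := by
  refine hB.of_ord_det (replaceRow_mem hB.row_mem i
    (Λ.sum_mem fun k _ => smul_mem_of_mem_holo (hr k) (hB.row_mem k))) ?_ ?_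
  · rw [det_replaceRow]
    exact mul_ne_zero h0 hB.det_ne_zero
  · rw [det_replaceRow, ord_mul h0 hB.det_ne_zero, h1, zero_add]

theorem ord_prod {d : Fin n → MeroGerm} (hd : ∀ i, d i ≠ 0) :
    ord (∏ i, d i) = ∑ i, ord (d i) := by
  have key (s : Finset (Fin n)) : ord (∏ i ∈ s, d i) = ∑ i ∈ s, ord (d i) := by
    classical
    induction s using Finset.induction_on with
    | empty => simp [ord_one]
    | insert a s ha ih =>
      rw [Finset.prod_insert ha, Finset.sum_insert ha,
        ord_mul (hd a) (Finset.prod_ne_zero_iff.2 fun i _ => hd i), ih]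
  exact key _

theorem ord_det_scaleRows {d : Fin n → MeroGerm} (hd : ∀ i, d i ≠ 0)
    {B : Matrix (Fin n) (Fin n) MeroGerm} (hB : B.det ≠ 0) :
    ord (scaleRows d B).det = ∑ i, ord (d i) + ord B.det := by
  rw [det_scaleRows, ord_mul (Finset.prod_ne_zero_iff.2 fun i _ => hd i) hB, ord_prod hd]

theorem IsLatticeBasis.scaleRows {Λ : Submodule holo (Fin n → MeroGerm)}
    {B : Matrix (Fin n) (Fin n) MeroGerm} (hB : IsLatticeBasis Λ B) {u : Fin n → MeroGerm}
    (h0 : ∀ i, u i ≠ 0) (h1 : ∀ i, ord (u i) = 0) :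
    IsLatticeBasis Λ (SphereBundle.scaleRows u B) := by
  refine hB.of_ord_det (fun i => smul_mem_of_mem_holo (mem_holo_of_ord (h1 i).ge) (hB.row_mem i))
    (det_scaleRows_ne_zero h0 hB.det_ne_zero) ?_
  rw [ord_det_scaleRows h0 hB.det_ne_zero]
  simp [h1]

theorem germAt_coord_mem {y : OnePoint ℂ} (hy : y ≠ OnePoint.infty) (p : ℂ) :
    germAt y (coord p) ∈ holo := by
  induction y using OnePoint.rec with
  | infty => exact absurd rfl hy
  | coe q =>
    rw [germAt_coord_coe]
    exact holo.add_mem (const_mem_holo _) unif_mem_holo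

theorem ord_germAt_coord {y : OnePoint ℂ} (hy : y ≠ OnePoint.infty) {p : ℂ} (hp : y ≠ p) :
    ord (germAt y (coord p)) = 0 := by
  induction y using OnePoint.rec with
  | infty => exact absurd rfl hy
  | coe q => exact (germAt_coord_of_ne fun h => hp (congrArg _ h)).2

/-! ### Frames of a bundle on the affine line -/

/-- Here `N` is the excess order of the determinant at `p`. While it is positive, some constant
combination of the rows is divisible by `z - p` in `Λ`; dividing it and substituting it for a row
lowers the excess by one. As `z - p` is a unit at the other finite points, nothing changes there.
Only infinity is left uncontrolled. -/
theorem exists_frame_of_ord {p : ℂ} {Λ : Submodule holo (Fin n → MeroGerm)}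
    {B : Matrix (Fin n) (Fin n) MeroGerm} (hB : IsLatticeBasis Λ B) (N : ℕ) :
    ∀ S : Matrix (Fin n) (Fin n) GlobalMero, (∀ y, (germMat y S).det ≠ 0) →
      (∀ i, germMat p S i ∈ Λ) → ord (germMat p S).det = ord B.det + N →
      ∃ S' : Matrix (Fin n) (Fin n) GlobalMero, (∀ y, (germMat y S').det ≠ 0) ∧
        IsLatticeBasis Λ (germMat p S') ∧
        ∀ y : OnePoint ℂ, y ≠ OnePoint.infty → y ≠ p → ∀ Λ',
          IsLatticeBasis Λ' (germMat y S) → IsLatticeBasis Λ' (germMat y S') := by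
  induction N with
  | zero =>
    intro S hS hΛ hN
    exact ⟨S, hS, hB.of_ord_det hΛ (hS p) (by simpa using hN), fun _ _ _ _ h => h⟩
  | succ N ih =>
    intro S hS hΛ hN
    obtain ⟨c, hc, hr⟩ := hB.exists_relation hΛ (hS p) (by push_cast at hN; omega)
    obtain ⟨i, hi⟩ := Function.ne_iff.1 hc
    let r : Fin n → GlobalMero := fun k => cst (c k) * globalZPow (coord p) (-1)
    have hrg (y : OnePoint ℂ) (k : Fin n) :
        germAt y (r k) = const (c k) * (germAt y (coord p))⁻¹ := by
      rw [map_mul, germAt_cst, germAt_inv]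
    have hr0 (y : OnePoint ℂ) : germAt y (r i) ≠ 0 := by
      rw [hrg]
      exact mul_ne_zero (const_ne_zero hi) (inv_ne_zero (germAt_coord_ne_zero y p))
    have hro (y : OnePoint ℂ) : ord (germAt y (r i)) = -ord (germAt y (coord p)) := by
      rw [hrg, ord_mul (const_ne_zero hi) (inv_ne_zero (germAt_coord_ne_zero y p)), ord_const hi,
        ord_inv (germAt_coord_ne_zero y p), zero_add]
    have hS' (y : OnePoint ℂ) : (germMat y (replaceRow S i r)).det ≠ 0 := by
      rw [germMat_replaceRow, det_replaceRow]
      exact mul_ne_zero (hr0 y) (hS y)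
    obtain ⟨S', h1, h2, h3⟩ := ih (replaceRow S i r) hS' (by
        rw [germMat_replaceRow]
        refine replaceRow_mem hΛ i ?_
        convert hr using 1
        rw [Finset.smul_sum]
        refine Finset.sum_congr rfl fun k _ => ?_
        rw [hrg, germAt_coord_self, smul_smul, mul_comm]) (by
        rw [germMat_replaceRow, det_replaceRow, ord_mul (hr0 p) (hS p), hN, hro,
          germAt_coord_self, ord_unif]
        push_cast
        ring)
    refine ⟨S', h1, h2, fun y hy hyp Λ' h => h3 y hy hyp Λ' ?_⟩
    rw [germMat_replaceRow]
    refine h.replaceRow (fun k => ?_) (hr0 y) (by rw [hro, ord_germAt_coord hy hyp, neg_zero])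
    rw [hrg]
    refine holo.mul_mem (const_mem_holo _) (mem_holo_of_ord ?_)
    rw [ord_inv (germAt_coord_ne_zero y p), ord_germAt_coord hy hyp, neg_zero]

/-- A generic frame can be turned into a frame of a given lattice at a point `p` of the affine
line, without changing the lattices it generates elsewhere on the affine line. -/
theorem exists_frame_at (p : ℂ) (Λ : LatticeOf n) (S : Matrix (Fin n) (Fin n) GlobalMero)
    (hS : ∀ y, (germMat y S).det ≠ 0) :
    ∃ S' : Matrix (Fin n) (Fin n) GlobalMero, (∀ y, (germMat y S').det ≠ 0) ∧
      IsLatticeBasis Λ.carrier (germMat p S') ∧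
      ∀ y : OnePoint ℂ, y ≠ OnePoint.infty → y ≠ p → ∀ Λ',
        IsLatticeBasis Λ' (germMat y S) → IsLatticeBasis Λ' (germMat y S') := by
  obtain ⟨B, hB⟩ := Λ.exists_matrix
  have hsp := isLatticeBasis_span (hS p)
  obtain ⟨N, hN⟩ := exists_unif_pow_smul_le Λ ⟨_, _, hsp⟩
  -- The factor `(z - p)^N` pushes the frame into `Λ` at `p` and is a unit elsewhere on the affine
  -- line.
  let S₁ := scaleRows (fun _ => coord p ^ N) S
  have hS₁ (y : OnePoint ℂ) :
      germMat y S₁ = scaleRows (fun _ => germAt y (coord p) ^ N) (germMat y S) := by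
    rw [germMat_scaleRows]
    simp only [map_pow]
  have h0 (y : OnePoint ℂ) : germAt y (coord p) ^ N ≠ 0 := pow_ne_zero _ (germAt_coord_ne_zero y p)
  have hdet (y : OnePoint ℂ) : (germMat y S₁).det ≠ 0 := by
    rw [hS₁]
    exact det_scaleRows_ne_zero (fun _ => h0 y) (hS y)
  have hmem (i : Fin n) : germMat p S₁ i ∈ Λ.carrier := by
    rw [hS₁, germAt_coord_self]
    exact hN (Submodule.smul_mem_pointwise_smul _ _ _ (hsp.row_mem i))
  have hle := hB.ord_det_le hmem (hdet p)
  obtain ⟨S', h1, h2, h3⟩ := exists_frame_of_ord hB (ord (germMat p S₁).det - ord B.det).toNat S₁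
    hdet hmem (by omega)
  refine ⟨S', h1, h2, fun y hy hyp Λ' h => h3 y hy hyp Λ' ?_⟩
  rw [hS₁]
  refine h.scaleRows (fun _ => h0 y) fun _ => ?_
  rw [← zpow_natCast, ord_zpow (germAt_coord_ne_zero y p), ord_germAt_coord hy hyp, mul_zero]

/-- A bundle on the sphere has a frame on the affine line. -/
theorem exists_affine_frame (E : VBundle n) :
    ∃ S : Matrix (Fin n) (Fin n) GlobalMero, (∀ y, (germMat y S).det ≠ 0) ∧
      ∀ y, y ≠ OnePoint.infty → IsLatticeBasis (E.stalk y) (germMat y S) := by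
  have key (T : Finset ℂ) : ∃ S : Matrix (Fin n) (Fin n) GlobalMero,
      (∀ y, (germMat y S).det ≠ 0) ∧
      ∀ q : ℂ, q ∈ T ∨ IsLatticeBasis (E.stalk q) (1 : Matrix (Fin n) (Fin n) MeroGerm) →
        IsLatticeBasis (E.stalk q) (germMat q S) := by
    classical
    induction T using Finset.induction_on with
    | empty =>
      have h1 (y : OnePoint ℂ) : germMat y (1 : Matrix (Fin n) (Fin n) GlobalMero) = 1 :=
        map_one (germAt y).mapMatrix
      exact ⟨1, fun y => by rw [h1, Matrix.det_one]; exact one_ne_zero, fun q hq => by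
        rw [h1]; simpa using hq⟩
    | insert p T hp ih =>
      obtain ⟨S, hS, hT⟩ := ih
      obtain ⟨S', h1, h2, h3⟩ := exists_frame_at p (E.lattice p) S hS
      refine ⟨S', h1, fun q hq => ?_⟩
      rcases eq_or_ne q p with rfl | hqp
      · exact h2
      · refine h3 q (OnePoint.coe_ne_infty q) (fun h => hqp (OnePoint.coe_injective h)) _ (hT q ?_)
        simpa [hqp] using hq
  have hfin : {q : ℂ | ¬ IsLatticeBasis (E.stalk q) (1 : Matrix (Fin n) (Fin n) MeroGerm)}.Finite :=
    (finite_not_isLatticeBasis_one E).preimage OnePoint.coe_injective.injOn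
  obtain ⟨S, hS, hT⟩ := key hfin.toFinset
  refine ⟨S, hS, fun y hy => ?_⟩
  induction y using OnePoint.rec with
  | infty => exact absurd rfl hy
  | coe q =>
    refine hT q ?_
    by_cases h : IsLatticeBasis (E.stalk q) (1 : Matrix (Fin n) (Fin n) MeroGerm)
    · exact Or.inr h
    · exact Or.inl (by simpa using h)

/-! ### The splitting theorem -/

/-- The same descent at infinity, with degrees `d` recording the twist of each row. The division by
`t` is absorbed in a degree, so the global frame changes only by polynomial row operations and still
generates the same lattices on the affine line. -/
theorem exists_splitting_of_ord {Λ : Submodule holo (Fin n → MeroGerm)}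
    {B : Matrix (Fin n) (Fin n) MeroGerm} (hB : IsLatticeBasis Λ B) (N : ℕ) :
    ∀ (S : Matrix (Fin n) (Fin n) GlobalMero) (d : Fin n → ℤ),
      (∀ i, scaleRows (fun i => unif ^ (-d i)) (germMat OnePoint.infty S) i ∈ Λ) →
      (germMat OnePoint.infty S).det ≠ 0 →
      ord (scaleRows (fun i => unif ^ (-d i)) (germMat OnePoint.infty S)).det = ord B.det + N →
      ∃ (S' : Matrix (Fin n) (Fin n) GlobalMero) (a : Fin n → ℤ),
        IsLatticeBasis Λ (scaleRows (fun i => unif ^ (-a i)) (germMat OnePoint.infty S')) ∧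
        ∀ y, y ≠ OnePoint.infty → ∀ Λ',
          IsLatticeBasis Λ' (germMat y S) → IsLatticeBasis Λ' (germMat y S') := by
  have hu (m : ℤ) : unif ^ m ≠ 0 := zpow_ne_zero _ unif_ne_zero
  induction N with
  | zero =>
    intro S d hΛ hS hN
    exact ⟨S, d, hB.of_ord_det hΛ (det_scaleRows_ne_zero (fun _ => hu _) hS) (by simpa using hN),
      fun _ _ _ h => h⟩
  | succ N ih =>
    intro S d hΛ hS hN
    set C := scaleRows (fun i => unif ^ (-d i)) (germMat OnePoint.infty S) with hC
    have hC0 : C.det ≠ 0 := det_scaleRows_ne_zero (fun _ => hu _) hS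
    obtain ⟨c, hc, hr⟩ := hB.exists_relation hΛ hC0 (by push_cast at hN; omega)
    classical
    obtain ⟨i₁, hi₁⟩ := Function.ne_iff.1 hc
    -- The row of least degree in the relation is the one replaced, so that the exponents `d k - d
    -- i` that matter are nonnegative and the coefficients `c k * z ^ (d k - d i)` are polynomials.
    obtain ⟨i, hi, hmin⟩ := Finset.exists_min_image (Finset.univ.filter fun i => c i ≠ 0) d
      ⟨i₁, by simpa using hi₁⟩
    have hci : c i ≠ 0 := by simpa using hi
    let r : Fin n → GlobalMero := fun k => cst (c k) * globalZPow (coord 0) (d k - d i)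
    have hrg (y : OnePoint ℂ) (k : Fin n) :
        germAt y (r k) = const (c k) * germAt y (coord 0) ^ (d k - d i) := by
      rw [map_mul, germAt_cst, germAt_zpow]
    have hri (y : OnePoint ℂ) : germAt y (r i) = const (c i) := by
      rw [hrg, sub_self, zpow_zero, mul_one]
    have hinf : germAt OnePoint.infty (coord 0) = unif⁻¹ := by
      rw [germAt_coord_infty, map_zero, sub_zero]
    let d' := Function.update d i (d i + 1)
    have hC' : scaleRows (fun k => unif ^ (-d' k)) (germMat OnePoint.infty (replaceRow S i r)) =
        replaceRow C i (fun k => unif⁻¹ * const (c k)) := by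
      rw [germMat_replaceRow]
      refine funext fun k => ?_
      rcases eq_or_ne k i with rfl | hk
      · have e1 : replaceRow C k (fun l => unif⁻¹ * const (c l)) k =
            ∑ l, (unif⁻¹ * const (c l)) • C l := Matrix.updateRow_self
        have e2 : scaleRows (fun k => unif ^ (-d' k)) (replaceRow (germMat OnePoint.infty S) k
            fun l => germAt OnePoint.infty (r l)) k = unif ^ (-d' k) •
              ∑ l, germAt OnePoint.infty (r l) • germMat OnePoint.infty S l :=
          congrArg (unif ^ (-d' k) • ·) Matrix.updateRow_self
        rw [e1, e2, Finset.smul_sum]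
        refine Finset.sum_congr rfl fun l _ => ?_
        have e3 : C l = unif ^ (-d l) • germMat OnePoint.infty S l := rfl
        have e4 : d' k = d k + 1 := Function.update_self _ _ _
        have e5 : unif ^ (-d' k) * germAt OnePoint.infty (r l) =
            unif⁻¹ * const (c l) * unif ^ (-d l) := by
          rw [hrg, hinf, inv_zpow', mul_left_comm, ← zpow_add₀ unif_ne_zero, mul_comm unif⁻¹,
            mul_assoc, ← zpow_neg_one, ← zpow_add₀ unif_ne_zero, e4]
          congr 2
          ring
        rw [e3, smul_smul, smul_smul, e5]
      · have e1 : replaceRow C i (fun l => unif⁻¹ * const (c l)) k = C k := Matrix.updateRow_ne hk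
        have e2 : scaleRows (fun k => unif ^ (-d' k)) (replaceRow (germMat OnePoint.infty S) i
            fun l => germAt OnePoint.infty (r l)) k =
              unif ^ (-d' k) • germMat OnePoint.infty S k :=
          congrArg (unif ^ (-d' k) • ·) (Matrix.updateRow_ne hk)
        have e3 : d' k = d k := Function.update_of_ne hk _ _
        rw [e1, e2, e3]
        rfl
    have hcu : unif⁻¹ * const (c i) ≠ 0 :=
      mul_ne_zero (inv_ne_zero unif_ne_zero) (const_ne_zero hci)
    obtain ⟨S', a, h1, h2⟩ := ih (replaceRow S i r) d' (by
        rw [hC']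
        refine replaceRow_mem hΛ i ?_
        convert hr using 1
        rw [Finset.smul_sum]
        exact Finset.sum_congr rfl fun k _ => mul_smul _ _ _) (by
        rw [germMat_replaceRow, det_replaceRow, hri]
        exact mul_ne_zero (const_ne_zero hci) hS) (by
        rw [hC', det_replaceRow, ord_mul hcu hC0, hN, ord_mul (inv_ne_zero unif_ne_zero)
          (const_ne_zero hci), ord_inv unif_ne_zero, ord_unif, ord_const hci]
        push_cast
        ring)
    refine ⟨S', a, h1, fun y hy Λ' h => h2 y hy Λ' ?_⟩
    rw [germMat_replaceRow]
    refine h.replaceRow (fun k => ?_) (by rw [hri]; exact const_ne_zero hci)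
      (by rw [hri, ord_const hci])
    rw [hrg]
    by_cases hk : c k = 0
    · rw [hk, map_zero, zero_mul]
      exact holo.zero_mem
    · have hle : d i ≤ d k := hmin k (by simpa using hk)
      obtain ⟨m, hm⟩ := Int.eq_ofNat_of_zero_le (sub_nonneg.2 hle)
      rw [hm, zpow_natCast]
      exact holo.mul_mem (const_mem_holo _) (holo.pow_mem (germAt_coord_mem hy 0) m)

/-- Every vector bundle on the sphere is a direct sum of line bundles. -/
theorem exists_splitting (E : VBundle n) :
    ∃ (S : Matrix (Fin n) (Fin n) GlobalMero) (a : Fin n → ℤ), Antitone a ∧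
      (∀ y, y ≠ OnePoint.infty → IsLatticeBasis (E.stalk y) (germMat y S)) ∧
      IsLatticeBasis (E.stalk OnePoint.infty)
        (scaleRows (fun i => unif ^ (-a i)) (germMat OnePoint.infty S)) := by
  obtain ⟨S, hS, hE⟩ := exists_affine_frame E
  obtain ⟨B, hB⟩ := (E.lattice OnePoint.infty).exists_matrix
  have hsp := isLatticeBasis_span (hS OnePoint.infty)
  obtain ⟨N, hN⟩ := exists_unif_pow_smul_le (E.lattice OnePoint.infty) ⟨_, _, hsp⟩
  have hmem (i : Fin n) : scaleRows (fun _ => unif ^ (-(-(N : ℤ)))) (germMat OnePoint.infty S) i ∈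
      (E.lattice OnePoint.infty).carrier := by
    rw [neg_neg, zpow_natCast]
    exact hN (Submodule.smul_mem_pointwise_smul _ _ _ (hsp.row_mem i))
  have hle := hB.ord_det_le hmem
    (det_scaleRows_ne_zero (fun _ => zpow_ne_zero _ unif_ne_zero) (hS OnePoint.infty))
  obtain ⟨m, hm⟩ := Int.le.dest hle
  obtain ⟨S', a, h1, h2⟩ := exists_splitting_of_ord hB m S (fun _ => -(N : ℤ)) hmem
    (hS OnePoint.infty) hm.symm
  -- Sorting `-a` increasingly makes the type decreasing.
  let σ := Tuple.sort fun i => -a i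
  refine ⟨fun i => S' (σ i), fun i => a (σ i), fun i j hij => ?_, fun y hy => ?_, ?_⟩
  · exact neg_le_neg_iff.1 (Tuple.monotone_sort (fun i => -a i) hij)
  · exact (h2 y hy _ (hE y hy)).reindex σ
  · exact h1.reindex σ

end SphereBundle

namespace SphereBundle

open MeroGerm

variable {n : ℕ}

/-! ### Sections as matrices -/

/-- A global meromorphic function as a meromorphic function on the whole sphere. -/
def toMeroFun (f : GlobalMero) : MeroFun Set.univ := ⟨f.1, fun y _ => f.2 y⟩

/-- The matrix of a family of global meromorphic sections. -/
def sectionMatrix (s : Fin n → Fin n → MeroFun Set.univ) : Matrix (Fin n) (Fin n) GlobalMero :=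
  fun i j => ⟨(s i j).1, fun y => (s i j).2 y (Set.mem_univ y)⟩

/-- The bundle with a given global frame. -/
def bundleOfMatrix (S : Matrix (Fin n) (Fin n) GlobalMero) (hS : ∀ y, (germMat y S).det ≠ 0) :
    VBundle n where
  stalk y := Submodule.span holo (Set.range (germMat y S : Fin n → Fin n → MeroGerm))
  locallyFree x := ⟨Set.univ, isOpen_univ, Set.mem_univ x, fun i j => toMeroFun (S i j),
    fun y _ => isLatticeBasis_span (hS y)⟩

theorem hasType_of_splitting {E : VBundle n} {S : Matrix (Fin n) (Fin n) GlobalMero}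
    {a : Fin n → ℤ} (ha : Antitone a)
    (h1 : ∀ y, y ≠ OnePoint.infty → IsLatticeBasis (E.stalk y) (germMat y S))
    (h2 : IsLatticeBasis (E.stalk OnePoint.infty)
      (scaleRows (fun i => unif ^ (-a i)) (germMat OnePoint.infty S))) : HasType E a := by
  refine ⟨ha, fun i j => toMeroFun (S i j), fun y => ?_⟩
  by_cases hy : y = OnePoint.infty
  · subst hy
    simp only [if_true]
    exact h2
  · simp only [if_neg hy, zpow_zero, one_smul]
    exact h1 y hy

/-- A frame of `E` outside `x` that splits the lattice of `E` at `x`. -/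
structure IsSplittingFrame (E : VBundle n) (x : OnePoint ℂ)
    (S : Matrix (Fin n) (Fin n) GlobalMero) (k : Fin n → ℤ) : Prop where
  off : ∀ y, y ≠ x → IsLatticeBasis (E.stalk y) (germMat y S)
  det_ne_zero : (germMat x S).det ≠ 0
  at_point : IsLatticeBasis (E.stalk x) (scaleRows (fun i => unif ^ (-k i)) (germMat x S))

theorem det_ne_zero_of_scaleRows {d : Fin n → MeroGerm} {B : Matrix (Fin n) (Fin n) MeroGerm}
    (h : (scaleRows d B).det ≠ 0) : B.det ≠ 0 := by
  rw [det_scaleRows] at h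
  exact right_ne_zero_of_mul h

theorem scaleRows_scaleRows (u v : Fin n → MeroGerm) (B : Matrix (Fin n) (Fin n) MeroGerm) :
    scaleRows u (scaleRows v B) = scaleRows (fun i => u i * v i) B :=
  funext fun i => (mul_smul (u i) (v i) (B i)).symm

theorem scaleRows_one (B : Matrix (Fin n) (Fin n) MeroGerm) : scaleRows (fun _ => 1) B = B :=
  funext fun i => one_smul MeroGerm (B i)

/-- The twist moves from infinity to `p` on multiplying row `i` by `(z - p)^{aᵢ}`: this has order
`aᵢ` at `p`, order `-aᵢ` at infinity, and is a unit elsewhere. -/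
theorem HasType.exists_isSplittingFrame {E : VBundle n} {a : Fin n → ℤ} (h : HasType E a)
    (x : OnePoint ℂ) : ∃ S, IsSplittingFrame E x S a := by
  obtain ⟨-, s, hs⟩ := h
  have h1 (y : OnePoint ℂ) (hy : y ≠ OnePoint.infty) :
      IsLatticeBasis (E.stalk y) (germMat y (sectionMatrix s)) := by
    have := hs y
    simp only [if_neg hy, zpow_zero, one_smul] at this
    exact this
  have h2 : IsLatticeBasis (E.stalk OnePoint.infty)
      (scaleRows (fun i => unif ^ (-a i)) (germMat OnePoint.infty (sectionMatrix s))) := by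
    have := hs OnePoint.infty
    simp only [if_true] at this
    exact this
  have h3 := det_ne_zero_of_scaleRows h2.det_ne_zero
  induction x using OnePoint.rec with
  | infty => exact ⟨_, h1, h3, h2⟩
  | coe p =>
    have hg (y : OnePoint ℂ) :
        germMat y (scaleRows (fun i => globalZPow (coord p) (a i)) (sectionMatrix s)) =
          scaleRows (fun i => germAt y (coord p) ^ a i) (germMat y (sectionMatrix s)) := by
      rw [germMat_scaleRows]
      simp only [germAt_zpow]
    have hz (y : OnePoint ℂ) (m : ℤ) : germAt y (coord p) ^ m ≠ 0 :=
      zpow_ne_zero _ (germAt_coord_ne_zero y p)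
    refine ⟨scaleRows (fun i => globalZPow (coord p) (a i)) (sectionMatrix s), fun y hy => ?_, ?_, ?_⟩
    · rw [hg]
      by_cases hy' : y = OnePoint.infty
      · subst hy'
        have h4 := h2.scaleRows (u := fun i => germAt OnePoint.infty (coord p) ^ a i * unif ^ a i)
          (fun i => mul_ne_zero (hz _ _) (zpow_ne_zero _ unif_ne_zero)) fun i => by
            rw [ord_mul (hz _ _) (zpow_ne_zero _ unif_ne_zero), ord_unif_zpow,
              ord_zpow (germAt_coord_ne_zero _ p), (ord_germAt_coord_infty p).2]
            ring
        rw [scaleRows_scaleRows] at h4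
        simpa only [mul_assoc, ← zpow_add₀ unif_ne_zero, add_neg_cancel, zpow_zero, mul_one]
          using h4
      · exact (h1 y hy').scaleRows (fun i => hz y _) fun i => by
          rw [ord_zpow (germAt_coord_ne_zero y p), ord_germAt_coord hy' hy, mul_zero]
    · rw [hg]
      exact det_scaleRows_ne_zero (fun i => hz _ _) (h1 _ (OnePoint.coe_ne_infty p)).det_ne_zero
    · rw [hg, germAt_coord_self, scaleRows_scaleRows]
      simp only [← zpow_add₀ unif_ne_zero, neg_add_cancel, zpow_zero]
      rw [scaleRows_one]
      exact h1 _ (OnePoint.coe_ne_infty p)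

theorem IsBGTrivialisation.exists_isSplittingFrame {E M : VBundle n} {x : OnePoint ℂ}
    (h : IsBGTrivialisation E M x) :
    ∃ S k, IsSplittingFrame E x S k ∧ IsLatticeBasis (M.stalk x) (germMat x S) := by
  obtain ⟨hoff, σ, hσ, k, hk⟩ := h
  refine ⟨sectionMatrix σ, k, ⟨fun y hy => ?_, (hσ x).det_ne_zero, hk⟩, hσ x⟩
  rw [hoff y hy]
  exact hσ y

theorem exists_matrix_of_mem_trivialisations {E F : VBundle n} {x : OnePoint ℂ}
    (h : F ∈ trivialisations E x) :
    ∃ T, (∀ y, y ≠ x → IsLatticeBasis (E.stalk y) (germMat y T)) ∧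
      IsLatticeBasis (F.stalk x) (germMat x T) := by
  obtain ⟨hoff, τ, hτ⟩ := h
  refine ⟨sectionMatrix τ, fun y hy => ?_, hτ x⟩
  rw [hoff y hy]
  exact hτ y

/-! ### Comparison of frames -/

/-- The matrix expressing `S` in terms of `T`. -/
def transitionMatrix (S T : Matrix (Fin n) (Fin n) GlobalMero) :
    Matrix (Fin n) (Fin n) GlobalMero :=
  globalZPow T.det (-1) • (S * T.adjugate)

theorem germMat_transitionMatrix (y : OnePoint ℂ) (S T : Matrix (Fin n) (Fin n) GlobalMero) :
    germMat y (transitionMatrix S T) = germMat y S * (germMat y T)⁻¹ := by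
  have h1 : germMat y (transitionMatrix S T) =
      germAt y (globalZPow T.det (-1)) • germMat y (S * T.adjugate) := by
    ext i j
    exact map_mul (germAt y) _ _
  have h2 : germMat y (S * T.adjugate) = germMat y S * (germMat y T).adjugate := by
    rw [germMat, map_mul, RingHom.map_adjugate]
    rfl
  rw [h1, h2, germAt_inv, ← det_germMat, Matrix.inv_def, Ring.inverse_eq_inv', Matrix.mul_smul]

theorem ord_transition_nonpos {E : VBundle n} {x : OnePoint ℂ}
    {S T : Matrix (Fin n) (Fin n) GlobalMero}
    (hS : ∀ y, y ≠ x → IsLatticeBasis (E.stalk y) (germMat y S))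
    (hT : ∀ y, y ≠ x → IsLatticeBasis (E.stalk y) (germMat y T)) (i j : Fin n)
    (h0 : (germMat x S * (germMat x T)⁻¹) i j ≠ 0) :
    ord ((germMat x S * (germMat x T)⁻¹) i j) ≤ 0 := by
  rw [← germMat_transitionMatrix] at h0 ⊢
  refine ord_germAt_nonpos (g := transitionMatrix S T i j) (fun y hy => ?_) h0
  have h1 : germAt y (transitionMatrix S T i j) = (germMat y S * (germMat y T)⁻¹) i j :=
    congrFun (congrFun (germMat_transitionMatrix y S T) i) j
  rw [h1]
  exact (hT y hy).entry_mem (hS y hy).row_mem i j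

/-- Liouville for the determinant of the transition matrix. Used in both directions it gives
equality, the invariance of the degree. -/
theorem ord_det_le_of_off {E : VBundle n} {x : OnePoint ℂ}
    {S T : Matrix (Fin n) (Fin n) GlobalMero}
    (hS : ∀ y, y ≠ x → IsLatticeBasis (E.stalk y) (germMat y S))
    (hT : ∀ y, y ≠ x → IsLatticeBasis (E.stalk y) (germMat y T))
    (hS0 : (germMat x S).det ≠ 0) (hT0 : (germMat x T).det ≠ 0) :
    ord (germMat x S).det ≤ ord (germMat x T).det := by
  have hg (y : OnePoint ℂ) : germAt y (transitionMatrix S T).det =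
      (germMat y S).det * (germMat y T).det⁻¹ := by
    rw [← det_germMat, germMat_transitionMatrix, det_mul_inv]
  have h := ord_germAt_nonpos (g := (transitionMatrix S T).det) (x := x) (fun y hy => by
    rw [← det_germMat, germMat_transitionMatrix]
    exact det_mem_holo ((hT y hy).entry_mem (hS y hy).row_mem)) (by
    rw [hg]
    exact mul_ne_zero hS0 (inv_ne_zero hT0))
  rw [hg, ord_mul hS0 (inv_ne_zero hT0), ord_inv hT0] at h
  omega

variable {E F : VBundle n} {x : OnePoint ℂ} {S T : Matrix (Fin n) (Fin n) GlobalMero}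
  {k : Fin n → ℤ}

/-- Row `i` of `S T⁻¹` has a nonzero entry, of order at most `0`. Since `β t^{-kᵢ}` times it is
holomorphic, `β` must vanish to order at least `kᵢ`. -/
theorem IsSplittingFrame.le_ord (h : IsSplittingFrame E x S k)
    (hT : ∀ y, y ≠ x → IsLatticeBasis (E.stalk y) (germMat y T))
    (hF : IsLatticeBasis (F.stalk x) (germMat x T)) {β : MeroGerm} (hβ : β ≠ 0)
    (hle : ∀ v ∈ E.stalk x, β • v ∈ F.stalk x) (i : Fin n) : k i ≤ ord β := by
  have hdet := det_mul_inv_ne_zero h.det_ne_zero hF.det_ne_zero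
  obtain ⟨j, hj⟩ : ∃ j, (germMat x S * (germMat x T)⁻¹) i j ≠ 0 := by
    by_contra! h0
    exact hdet (Matrix.det_eq_zero_of_row_eq_zero i h0)
  have h1 := ord_transition_nonpos h.off hT i j hj
  have hz : unif ^ (-k i) ≠ 0 := zpow_ne_zero _ unif_ne_zero
  have h2 : β * (unif ^ (-k i) * (germMat x S * (germMat x T)⁻¹) i j) ∈ holo := by
    have h3 := hF.mem_iff.1 (hle _ (h.at_point.row_mem i)) j
    have h4 : scaleRows (fun i => unif ^ (-k i)) (germMat x S) i =
      unif ^ (-k i) • (germMat x S).row i := rfl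
    rw [h4, Matrix.smul_vecMul, Matrix.smul_vecMul] at h3
    rwa [Matrix.mul_apply_eq_vecMul]
  have h3 := ord_nonneg_of_mem h2 (mul_ne_zero hβ (mul_ne_zero hz hj))
  rw [ord_mul hβ (mul_ne_zero hz hj), ord_mul hz hj, ord_unif_zpow] at h3
  omega

theorem vecMul_inv_scaleRows_zpow (k : Fin n → ℤ) (A : Matrix (Fin n) (Fin n) MeroGerm)
    (v : Fin n → MeroGerm) (i : Fin n) :
    (v ᵥ* (scaleRows (fun i => unif ^ (-k i)) A)⁻¹) i = unif ^ k i * (v ᵥ* A⁻¹) i := by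
  have hd : scaleRows (fun i => unif ^ (-k i)) A = Matrix.diagonal (fun i => unif ^ (-k i)) * A := by
    ext i j
    rw [Matrix.diagonal_mul]
    rfl
  have hi : (Matrix.diagonal fun i => unif ^ (-k i))⁻¹ = Matrix.diagonal fun i => unif ^ k i := by
    refine Matrix.inv_eq_right_inv ?_
    rw [Matrix.diagonal_mul_diagonal, ← Matrix.diagonal_one]
    congr 1
    refine funext fun i => ?_
    rw [← zpow_add₀ unif_ne_zero, neg_add_cancel, zpow_zero]
  rw [hd, Matrix.mul_inv_rev, hi, ← Matrix.vecMul_vecMul, Matrix.vecMul_diagonal, mul_comm]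

/-- Dual to `IsSplittingFrame.le_ord`, with a nonzero entry in column `i` of `T S⁻¹`. -/
theorem IsSplittingFrame.neg_le_ord (h : IsSplittingFrame E x S k)
    (hT : ∀ y, y ≠ x → IsLatticeBasis (E.stalk y) (germMat y T))
    (hF : IsLatticeBasis (F.stalk x) (germMat x T)) {β : MeroGerm} (hβ : β ≠ 0)
    (hle : ∀ v ∈ F.stalk x, β • v ∈ E.stalk x) (i : Fin n) : -k i ≤ ord β := by
  have hdet := det_mul_inv_ne_zero hF.det_ne_zero h.det_ne_zero
  obtain ⟨j, hj⟩ : ∃ j, (germMat x T * (germMat x S)⁻¹) j i ≠ 0 := by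
    by_contra! h0
    exact hdet (Matrix.det_eq_zero_of_column_eq_zero i h0)
  have h1 := ord_transition_nonpos hT h.off j i hj
  have hz : unif ^ k i ≠ 0 := zpow_ne_zero _ unif_ne_zero
  have h2 : unif ^ k i * (β * (germMat x T * (germMat x S)⁻¹) j i) ∈ holo := by
    have h3 := h.at_point.mem_iff.1 (hle _ (hF.row_mem j)) i
    rw [vecMul_inv_scaleRows_zpow, Matrix.smul_vecMul] at h3
    rwa [Matrix.mul_apply_eq_vecMul]
  have h3 := ord_nonneg_of_mem h2 (mul_ne_zero hz (mul_ne_zero hβ hj))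
  rw [ord_mul hz (mul_ne_zero hβ hj), ord_mul hβ hj, ord_unif_zpow] at h3
  omega

/-! ### The building distance to a trivialisation -/

theorem IsSplittingFrame.sub_le_buildingDist (h : IsSplittingFrame E x S k)
    (hF : F ∈ trivialisations E x) (i j : Fin n) :
    k i - k j ≤ buildingDist (E.lattice x) (F.lattice x) := by
  obtain ⟨T, hT, hTx⟩ := exists_matrix_of_mem_trivialisations hF
  obtain ⟨α, hα, h1, h2⟩ := sandwiched_buildingDist (E.lattice x) (F.lattice x)
  set r := buildingDist (E.lattice x) (F.lattice x)
  have hr : unif ^ r ≠ 0 := pow_ne_zero _ unif_ne_zero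
  have h3 := h.le_ord hT hTx (β := α⁻¹ * unif ^ r) (mul_ne_zero (inv_ne_zero hα) hr)
    (fun v hv => by
      obtain ⟨w, hw, hwv⟩ := (Submodule.mem_smul_pointwise_iff_exists _ _ _).1
        (h1 (Submodule.smul_mem_pointwise_smul _ _ _ hv))
      rw [mul_smul, ← hwv, inv_smul_smul₀ hα]
      exact hw) i
  have h4 := h.neg_le_ord hT hTx hα
    (fun v hv => h2 (Submodule.smul_mem_pointwise_smul _ _ _ hv)) j
  rw [ord_mul (inv_ne_zero hα) hr, ord_inv hα, ← zpow_natCast, ord_unif_zpow] at h3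
  omega

theorem IsSplittingFrame.buildingDist_le (h : IsSplittingFrame E x S k) {M : VBundle n}
    (hM : IsLatticeBasis (M.stalk x) (germMat x S)) {i j : Fin n} (hi : ∀ l, k l ≤ k i)
    (hj : ∀ l, k j ≤ k l) :
    (buildingDist (E.lattice x) (M.lattice x) : ℤ) ≤ k i - k j := by
  obtain ⟨r, hr⟩ := Int.eq_ofNat_of_zero_le (sub_nonneg.2 (hi j))
  rw [hr]
  have hz (m : ℤ) : unif ^ m ≠ 0 := zpow_ne_zero _ unif_ne_zero
  have hrow (l : Fin n) : scaleRows (fun l => unif ^ (-k l)) (germMat x S) l =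
    unif ^ (-k l) • germMat x S l := rfl
  -- With `k j` minimal, `t^{-kⱼ}` scales `M` into `Λ`; with `k i` maximal, the result contains
  -- `t^{kᵢ - kⱼ} Λ`.
  refine Int.ofNat_le.2 (SphereBundle.buildingDist_le ⟨unif ^ (-k j), hz _, ?_, ?_⟩)
  · refine h.at_point.smul_le fun l => ?_
    have e : unif ^ r • scaleRows (fun l => unif ^ (-k l)) (germMat x S) l =
        unif ^ (-k j) • (unif ^ (k i - k l) • germMat x S l) := by
      rw [hrow, ← zpow_natCast, smul_smul, smul_smul, ← zpow_add₀ unif_ne_zero,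
        ← zpow_add₀ unif_ne_zero]
      congr 2
      omega
    rw [e]
    refine Submodule.smul_mem_pointwise_smul _ _ _
      (smul_mem_of_mem_holo (mem_holo_of_ord ?_) (hM.row_mem l))
    rw [ord_unif_zpow]
    exact sub_nonneg.2 (hi l)
  · refine hM.smul_le fun l => ?_
    have e : unif ^ (-k j) • germMat x S l =
        unif ^ (k l - k j) • scaleRows (fun l => unif ^ (-k l)) (germMat x S) l := by
      rw [hrow, smul_smul, ← zpow_add₀ unif_ne_zero]
      congr 2
      omega
    rw [e]
    refine smul_mem_of_mem_holo (mem_holo_of_ord ?_) (h.at_point.row_mem l)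
    rw [ord_unif_zpow]
    exact sub_nonneg.2 (hj l)

theorem isLeast_buildingDist [NeZero n] {M : VBundle n} (hM : IsBGTrivialisation E M x) :
    IsLeast {d : ℕ | ∃ F ∈ trivialisations E x, d = buildingDist (E.lattice x) (F.lattice x)}
      (buildingDist (E.lattice x) (M.lattice x)) := by
  refine ⟨⟨M, ⟨hM.1, hM.2.choose, hM.2.choose_spec.1⟩, rfl⟩, ?_⟩
  rintro _ ⟨F, hF, rfl⟩
  obtain ⟨S, k, hS, hMS⟩ := hM.exists_isSplittingFrame
  obtain ⟨i, hi⟩ := Finite.exists_max k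
  obtain ⟨j, hj⟩ := Finite.exists_min k
  exact Int.ofNat_le.1 ((hS.buildingDist_le hMS hi hj).trans (hS.sub_le_buildingDist hF i j))

/-! ### The triviality index -/

theorem exists_isTrivialityIndex [NeZero n] (E : VBundle n) : ∃ m, IsTrivialityIndex E m := by
  obtain ⟨S, a, ha, h1, h2⟩ := exists_splitting E
  exact ⟨_, a, hasType_of_splitting ha h1 h2, rfl⟩

/-- Both sums measure the order of a determinant of a basis of `F_x` relative to one of `Λ`, once
`ord_det_le_of_off` identifies the orders for `S` and `T`. -/
theorem IsSplittingFrame.sum_eq (h : IsSplittingFrame E x S k)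
    (hF : F ∈ trivialisations E x) {k' : Fin n → ℤ}
    (hk' : IsElementaryDivisors (E.lattice x) (F.lattice x) k') : ∑ i, k' i = ∑ i, k i := by
  obtain ⟨T, hT, hTx⟩ := exists_matrix_of_mem_trivialisations hF
  obtain ⟨-, e, he, he'⟩ := hk'
  have hz (m : ℤ) : unif ^ m ≠ 0 := zpow_ne_zero _ unif_ne_zero
  have h1 := ord_det_scaleRows (fun i => hz (k' i)) he.det_ne_zero
  have h2 : ord (scaleRows (fun i => unif ^ k' i) e).det = ord (germMat x T).det :=
    IsLatticeBasis.ord_det_eq he' hTx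
  have h3 := ord_det_scaleRows (fun i => hz (-k i)) h.det_ne_zero
  have h4 := IsLatticeBasis.ord_det_eq h.at_point he
  have h5 := ord_det_le_of_off h.off hT h.det_ne_zero hTx.det_ne_zero
  have h6 := ord_det_le_of_off hT h.off hTx.det_ne_zero h.det_ne_zero
  simp only [ord_unif_zpow, Finset.sum_neg_distrib] at h1 h3
  omega

theorem IsSplittingFrame.le_of_elementaryDivisors (h : IsSplittingFrame E x S k)
    (hF : F ∈ trivialisations E x) {k' : Fin n → ℤ}
    (hk' : IsElementaryDivisors (E.lattice x) (F.lattice x) k') {m : ℤ} (hm : ∀ i, k' i ≤ m)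
    (i : Fin n) : k i ≤ m := by
  obtain ⟨T, hT, hTx⟩ := exists_matrix_of_mem_trivialisations hF
  obtain ⟨-, e, he, he'⟩ := hk'
  rw [← ord_unif_zpow m]
  refine h.le_ord hT hTx (zpow_ne_zero _ unif_ne_zero) (fun v hv => ?_) i
  refine IsLatticeBasis.smul_le he (N := F.stalk x) (fun l => ?_)
    (Submodule.smul_mem_pointwise_smul _ _ _ hv)
  have e1 : unif ^ m • e l = unif ^ (m - k' l) • (unif ^ k' l • e l) := by
    rw [smul_smul, ← zpow_add₀ unif_ne_zero, sub_add_cancel]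
  rw [e1]
  refine smul_mem_of_mem_holo (mem_holo_of_ord ?_) (IsLatticeBasis.row_mem he' l)
  rw [ord_unif_zpow]
  exact sub_nonneg.2 (hm l)

theorem sum_sub_eq (c : ℤ) (k : Fin n → ℤ) : ∑ j, (c - k j) = n * c - ∑ j, k j := by
  simp

theorem isLeast_seqIndex [NeZero n] (E : VBundle n) (x : OnePoint ℂ) {m : ℤ}
    (hm : IsTrivialityIndex E m) :
    IsLeast {i : ℤ | ∃ F ∈ trivialisations E x, ∃ k : Fin n → ℤ,
      IsElementaryDivisors (E.lattice x) (F.lattice x) k ∧ i = seqIndex k} m := by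
  obtain ⟨a, ha, rfl⟩ := hm
  obtain ⟨S, hS⟩ := ha.exists_isSplittingFrame x
  have hmax (i : Fin n) : a i ≤ a 0 := ha.1 (Fin.zero_le i)
  constructor
  · have hdet (y : OnePoint ℂ) : (germMat y S).det ≠ 0 := by
      rcases eq_or_ne y x with rfl | hy
      exacts [hS.det_ne_zero, (hS.off y hy).det_ne_zero]
    have hspan (y : OnePoint ℂ) :
        IsLatticeBasis ((bundleOfMatrix S hdet).stalk y) (germMat y S) :=
      isLatticeBasis_span (hdet y)
    -- The minimum is attained by the bundle with global frame `S`. The order is reversed because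
    -- elementary divisors increase while the type decreases.
    refine ⟨bundleOfMatrix S hdet, ⟨fun y hy => (hS.off y hy).2.2.symm,
      fun i j => toMeroFun (S i j), hspan⟩, fun i => a (Fin.rev i), ⟨?_, ?_⟩, ?_⟩
    · exact fun i j hij => ha.1 (Fin.rev_le_rev.2 hij)
    · refine ⟨_, hS.at_point.reindex Fin.revPerm, ?_⟩
      refine Eq.mp (congrArg (IsLatticeBasis _) ?_) ((hspan x).reindex Fin.revPerm)
      refine (funext fun i => ?_ : _ = _).symm
      refine Eq.trans (mul_smul (unif ^ a (Fin.rev i)) (unif ^ (-a (Fin.rev i)))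
        (germMat x S (Fin.rev i))).symm ?_
      rw [← zpow_add₀ unif_ne_zero, add_neg_cancel, zpow_zero, one_smul]
      rfl
    · have hsup : Finset.univ.sup' Finset.univ_nonempty (fun i => a (Fin.rev i)) = a 0 := by
        refine le_antisymm (Finset.sup'_le _ _ fun i _ => hmax _) ?_
        have := Finset.le_sup' (fun i => a (Fin.rev i)) (Finset.mem_univ (Fin.rev (0 : Fin n)))
        rwa [Fin.rev_rev] at this
      rw [seqIndex, hsup]
      exact (Equiv.sum_comp Fin.revPerm fun i => a 0 - a i).symm
  · rintro _ ⟨F, hF, k, hk, rfl⟩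
    have h1 := hS.sum_eq hF hk
    have h2 := hS.le_of_elementaryDivisors hF hk (m := Finset.univ.sup' Finset.univ_nonempty k)
      (fun i => Finset.le_sup' k (Finset.mem_univ i)) 0
    -- With equal sums, comparing indices amounts to comparing the maxima, and the largest entry of
    -- the type is `a 0`.
    rw [seqIndex, sum_sub_eq, sum_sub_eq, h1]
    exact sub_le_sub_right (mul_le_mul_of_nonneg_left h2 (Int.natCast_nonneg n)) _

end SphereBundle

end

theorem mainTheorem10 (n : ℕ) [NeZero n] (E : SphereBundle.VBundle n) (x : OnePoint ℂ) :
    (∀ M : SphereBundle.VBundle n, SphereBundle.IsBGTrivialisation E M x →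
      IsLeast {d : ℕ | ∃ F ∈ SphereBundle.trivialisations E x,
          d = SphereBundle.buildingDist (E.lattice x) (F.lattice x)}
        (SphereBundle.buildingDist (E.lattice x) (M.lattice x))) ∧
    (∃ m : ℤ, SphereBundle.IsTrivialityIndex E m) ∧
    (∀ m : ℤ, SphereBundle.IsTrivialityIndex E m →
      IsLeast {i : ℤ | ∃ F ∈ SphereBundle.trivialisations E x, ∃ k : Fin n → ℤ,
          SphereBundle.IsElementaryDivisors (E.lattice x) (F.lattice x) k ∧
            i = SphereBundle.seqIndex k} m) := by
  exact ⟨fun _ hM => SphereBundle.isLeast_buildingDist hM, SphereBundle.exists_isTrivialityIndex E,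
    fun _ hm => SphereBundle.isLeast_seqIndex E x hm⟩
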